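/- **Setting.** Let $(\mathsf X,\mathcal X)$ be a measurable space with countably generated $\sigma$-field, $(\Theta,\mathcal T)$ a measurable space, $\pi$ a probability measure on $\mathsf X$, and $\{P_\theta,\theta\in\Theta\}$ a family of Markov kernels on $\mathsf X$ such that $(\theta,x)\mapsto P_\theta(x,A)$ is measurable for each $A\in\mathcal X$. Let $\bar\mu$ be a probability measure on $\mathsf X\times\Theta$. Let $\{(X_n,\theta_n),n\ge0\}$ be an $\mathsf X\times\Theta$-valued process on a probability space with law $\mathbb P$, with natural filtration $\mathcal F_n=\sigma\{(X_k,\theta_k),k\le n\}$, such that $(X_0,\theta_0)\sim\bar\mu$ and, for each $n\ge0$ and each nonnegative measurable $f$, $\mathbb E(f(X_{n+1})\mid\mathcal F_n)=\int P_{\theta_n}(X_n,dy)f(y)$ $\mathbb P$-a.s. (the conditional law of $\theta_{n+1}$ given $\mathcal F_n$ and $X_{n+1}$ is arbitrary). For $W:\mathsf X\to[1,\infty)$ put $|f|_W=\sup_x|f(x)|/W(x)$, let $\mathcal L_W$ be the set of measurable $f:\mathsf X\to\mathbb R$ with $|f|_W<\infty$, and put $\|\mu-\nu\|_W=\sup_{|g|_W\le1}|\mu(g)-\nu(g)|$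 (supremum over measurable $g$). **Assumption A1.** For each $\theta\in\Theta$, $P_\theta$ is phi-irreducible and aperiodic with invariant distribution $\pi$. There is a measurable function $V:\mathsf X\to[1,\infty)$ with $\int V(x)\,\bar\mu(dx,d\theta)<\infty$ such that for every $\beta\in(0,1]$ there exist $\rho\in(0,1)$ and $C\in(0,\infty)$ with $$\|P_\theta^n(x,\cdot)-\pi\|_{V^\beta}\le C\rho^nV^\beta(x)\qquad\text{for all }(x,\theta)\in\mathsf X\times\Theta,\ n\ge0,\tag{1}$$ and there exist $b\in(0,\infty)$, $\lambda\in(0,1)$ with $P_\theta V(x)\le\lambda V(x)+b$ for all $(x,\theta)\in\mathsf X\times\Theta$. For $\beta\in[0,1]$ and $\theta,\theta'\in\Theta$ put $$D_\beta(\theta,\theta')=\sup_{|f|_{V^\beta}\le1}\ \sup_{x\in\mathsf X}\frac{|P_\theta f(x)-P_{\theta'}f(x)|}{V^\beta(x)}.$$ For a function $h$ put $g_\theta(x)=\sum_{j\ge0}\bar P_\theta^jh(x)$, where $\bar P_\theta f=P_\theta f-\pi(f)$, and $G_\theta(x,y)=g_\theta(y)-\int P_\theta(x,dz)g_\theta(z)$.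 **Proposition 3.1.** Assume A1. Let $\beta\in[0,1/2)$; if $\beta=0$, assume in addition that (1) also holds with $\beta=0$ (that is, with $V^\beta\equiv1$, for some $\rho\in(0,1)$ and $C\in(0,\infty)$). Let $h\in\mathcal L_{V^\beta}$ with $\pi(h)=0$. Suppose that there is a nonnegative random variable $\Gamma^2(h)$, finite $\mathbb P$-a.s., such that $$\lim_{n\to\infty}\frac1n\sum_{k=1}^nG^2_{\theta_{k-1}}(X_{k-1},X_k)=\Gamma^2(h)\quad\text{in }\mathbb P\text{-probability},$$ and that $$\sum_{k\ge1}k^{-1/2}D_\beta(\theta_k,\theta_{k-1})V^\beta(X_k)<\infty\quad\mathbb P\text{-a.s.}$$ Then $n^{-1/2}\sum_{k=1}^nh(X_k)$ converges weakly to the law of $\sqrt{\Gamma^2(h)}\,Z$, where $Z\sim\mathcal N(0,1)$ is independent of $\Gamma^2(h)$. -/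

import Mathlib

open MeasureTheory ProbabilityTheory Filter
open scoped ENNReal NNReal

namespace AdaptiveMCMC

noncomputable section

/-- The `W`-norm `|f|_W = sup_x |f x| / W x` of a function, as an extended nonnegative real. -/
def wNorm {S : Type*} (W f : S → ℝ) : ℝ≥0∞ :=
  ⨆ x, ENNReal.ofReal (|f x| / W x)

/-- `f ∈ 𝓛_W`: `f` is measurable and has finite `W`-norm. -/
def MemLW {S : Type*} [MeasurableSpace S] (W f : S → ℝ) : Prop :=
  Measurable f ∧ wNorm W f < ∞

/-- The `W`-norm of the signed measure `μ - ν`: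
`‖μ - ν‖_W = sup {|μ(g) - ν(g)| : g measurable, |g|_W ≤ 1}`. -/
def wDist {S : Type*} [MeasurableSpace S] (W : S → ℝ) (μ ν : Measure S) : ℝ≥0∞ :=
  ⨆ (g : S → ℝ) (_ : Measurable g) (_ : wNorm W g ≤ 1),
    ENNReal.ofReal |(∫ y, g y ∂μ) - ∫ y, g y ∂ν|

/-- The pseudo-metric
`D_β(θ, θ') = sup_{|f|_{V^β} ≤ 1} sup_x |P_θ f(x) - P_θ' f(x)| / V^β(x)`. -/
def kernelDist {𝓧 Θ : Type*} [MeasurableSpace 𝓧] (P : Θ → Kernel 𝓧 𝓧) (V : 𝓧 → ℝ) (β : ℝ)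
    (θ θ' : Θ) : ℝ≥0∞ :=
  ⨆ (f : 𝓧 → ℝ) (_ : Measurable f) (_ : wNorm (fun x => V x ^ β) f ≤ 1),
    ⨆ x, ENNReal.ofReal (|(∫ y, f y ∂(P θ x)) - ∫ y, f y ∂(P θ' x)| / V x ^ β)

/-- A Markov kernel with invariant distribution `π` is aperiodic if there is no cycle of `d ≥ 2`
pairwise disjoint measurable sets of positive `π`-measure, each of which is mapped almost surely
to the next one. -/
def IsAperiodic {𝓧 : Type*} [MeasurableSpace 𝓧] (κ : Kernel 𝓧 𝓧) (π : Measure 𝓧) : Prop :=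
  ¬ ∃ (d : ℕ) (E : ZMod d → Set 𝓧), 2 ≤ d ∧ (∀ i, MeasurableSet (E i)) ∧
      Pairwise (Function.onFun Disjoint E) ∧ (∀ i, 0 < π (E i)) ∧
      ∀ i, ∀ x ∈ E i, κ x (E (i + 1)) = 1

/-- Geometric ergodicity at exponent `β`, uniformly in `θ`:
`‖P_θ^n(x, ·) - π‖_{V^β} ≤ C ρ^n V^β(x)` for all `x`, `θ` and `n ≥ 0`. -/
def GeomErgodic {𝓧 Θ : Type*} [MeasurableSpace 𝓧] (P : Θ → Kernel 𝓧 𝓧) (π : Measure 𝓧)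
    (V : 𝓧 → ℝ) (β : ℝ) : Prop :=
  ∃ ρ C : ℝ, 0 < ρ ∧ ρ < 1 ∧ 0 < C ∧ ∀ (x : 𝓧) (θ : Θ) (n : ℕ),
    wDist (fun y => V y ^ β) ((P θ ^ n) x) π ≤ ENNReal.ofReal (C * ρ ^ n * V x ^ β)

/-- The geometric ergodicity assumption on the family `(P_θ)`, with invariant distribution `π`,
Lyapunov function `V` and initial distribution `μ₀` of `(X₀, θ₀)`. -/
structure AssumptionA1 {𝓧 Θ : Type*} [MeasurableSpace 𝓧] [MeasurableSpace Θ]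
    (P : Θ → Kernel 𝓧 𝓧) (π : Measure 𝓧) (μ₀ : Measure (𝓧 × Θ)) (V : 𝓧 → ℝ) : Prop where
  irreducible : ∀ θ, ∃ φ : Measure 𝓧, SigmaFinite φ ∧ φ ≠ 0 ∧ Kernel.IsIrreducible φ (P θ)
  aperiodic : ∀ θ, IsAperiodic (P θ) π
  invariant : ∀ θ, Kernel.Invariant (P θ) π
  measurable_V : Measurable V
  one_le_V : ∀ x, 1 ≤ V x
  initial : ∫⁻ p, ENNReal.ofReal (V p.1) ∂μ₀ < ∞
  ergodic : ∀ β : ℝ, 0 < β → β ≤ 1 → GeomErgodic P π V β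
  drift : ∃ b lam : ℝ, 0 < b ∧ 0 < lam ∧ lam < 1 ∧ ∀ (x : 𝓧) (θ : Θ),
    ∫⁻ y, ENNReal.ofReal (V y) ∂(P θ x) ≤ ENNReal.ofReal (lam * V x + b)

/-- The natural filtration `𝓕_n = σ((X_k, θ_k), k ≤ n)`. -/
@[reducible] def hist {Ω 𝓧 Θ : Type*} [MeasurableSpace 𝓧] [MeasurableSpace Θ]
    (X : ℕ → Ω → 𝓧) (θ : ℕ → Ω → Θ) (n : ℕ) : MeasurableSpace Ω :=
  ⨆ (k : ℕ) (_ : k ≤ n), MeasurableSpace.comap (fun ω => (X k ω, θ k ω)) inferInstance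

/-- `(X_n, θ_n)` has initial law `μ₀` and, given `𝓕_n`, the law of `X_{n+1}` is
`P_{θ_n}(X_n, ·)`; the conditional law of `θ_{n+1}` given `𝓕_n` and `X_{n+1}` is arbitrary. -/
structure IsAdaptiveMarkovChain {Ω 𝓧 Θ : Type*} [MeasurableSpace Ω] [MeasurableSpace 𝓧]
    [MeasurableSpace Θ] (P : Θ → Kernel 𝓧 𝓧) (μ₀ : Measure (𝓧 × Θ))
    (X : ℕ → Ω → 𝓧) (θ : ℕ → Ω → Θ) (Pr : Measure Ω) : Prop where
  measurable_X : ∀ n, Measurable (X n)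
  measurable_θ : ∀ n, Measurable (θ n)
  initial : Pr.map (fun ω => (X 0 ω, θ 0 ω)) = μ₀
  transition : ∀ (n : ℕ) (f : 𝓧 → ℝ), Measurable f → (∀ x, 0 ≤ f x) →
    Integrable (fun ω => f (X (n + 1) ω)) Pr →
    Pr[fun ω => f (X (n + 1) ω) | hist X θ n] =ᵐ[Pr]
      fun ω => ∫ y, f y ∂(P (θ n ω) (X n ω))

/-- The operator `P̄ = P - π` on functions: `P̄ f(x) = P f(x) - π(f)`. -/
def centered {𝓧 : Type*} [MeasurableSpace 𝓧] (κ : Kernel 𝓧 𝓧) (π : Measure 𝓧)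
    (f : 𝓧 → ℝ) : 𝓧 → ℝ :=
  fun x => (∫ y, f y ∂(κ x)) - ∫ y, f y ∂π

/-- The resolvent function `g(x) = ∑_{j ≥ 0} P̄^j h(x)`. -/
def resolvent {𝓧 : Type*} [MeasurableSpace 𝓧] (κ : Kernel 𝓧 𝓧) (π : Measure 𝓧)
    (h : 𝓧 → ℝ) : 𝓧 → ℝ :=
  fun x => ∑' j : ℕ, ((centered κ π)^[j] h) x

/-- `G(x, y) = g(y) - P g(x)`. -/
def mgIncrement {𝓧 : Type*} [MeasurableSpace 𝓧] (κ : Kernel 𝓧 𝓧) (π : Measure 𝓧)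
    (h : 𝓧 → ℝ) (x y : 𝓧) : ℝ :=
  resolvent κ π h y - ∫ z, resolvent κ π h z ∂(κ x)

end

end AdaptiveMCMC

/-! For each parameter, the resolvent `g` of `h` solves the Poisson equation `g - P g = h`, the
series converging by geometric ergodicity. Substituting it along the chain (`sum_Icc_eq_sum_add`)
writes the partial sum of `h` as a martingale with increments `G`, plus a boundary term, plus the
sum of the changes of `g` at `X (k + 1)` caused by the move from `θ k` to `θ (k + 1)`. After
division by `√n` the last two vanish almost surely. The boundary term is of order `V ^ β` at `X n`;
the drift bounds the mean of `V (X n)`, and `β < 1/2` turns this into a bounded moment of `V ^ β` of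
some order `p > 2`, so `ae_tendsto_inv_sqrt_mul` applies. The changes of `g` are Lipschitz in the
kernel distance (`abs_resolvent_sub_le`), and the summability hypothesis with Kronecker's lemma
(`tendsto_inv_sqrt_mul_sum`) disposes of their sum.

The martingale needs a central limit theorem with a random limiting variance,
`tendsto_integral_exp_martingale`, proved by McLeish's method. Since `exp (iu)` is `(1 + iu) exp
(-u²/2)` up to third order, the exponential of the normalised martingale is close to `T n * exp (-t²
U n / 2)`, where `T n` is the product of the factors `1 + it D j / √n` and `U n` is the normalised
quadratic variation, which tends to `Γ`. Freezing the product once the quadratic variation exceeds a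
level `C` keeps it a martingale of mean one and bounds it in L² uniformly in `n`. Then `T n - 1`
becomes orthogonal, as `n` grows, to every bounded variable known at a fixed time `m`, hence to
bounded continuous functions of `Γ`, the limit of the `U m`. So the characteristic functions tend to
the mean of `exp (-t² Γ / 2)`, that of `√Γ Z`. A cutoff in `Γ` matched to the stopping level is
removed at the end. -/

open scoped Topology

namespace AdaptiveMCMC

/-! ### Pointwise estimates for the products of the factors 1 + iu. -/

section StoppedProduct

lemma one_le_norm_one_add_mul_I (u : ℝ) : 1 ≤ ‖1 + (u : ℂ) * Complex.I‖ := by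
  have h := Complex.abs_re_le_norm (1 + (u : ℂ) * Complex.I)
  simpa using h

lemma norm_one_add_mul_I_sq (u : ℝ) : ‖1 + (u : ℂ) * Complex.I‖ ^ 2 = 1 + u ^ 2 := by
  rw [← Complex.normSq_eq_norm_sq, Complex.normSq_apply]
  simp
  ring

/-- The Taylor expansions agree through order two. For `|u| ≤ 1` the error is cubic, and `p ≤ 3`
lets `|u| ^ p` dominate it; for `|u| > 1` the triangle inequality suffices. The factor `‖1 + iu‖` on
the right is what lets the bound propagate through products. -/
lemma norm_exp_sub_one_add_mul_exp_le {p : ℝ} (hp2 : 2 ≤ p) (hp3 : p ≤ 3) (u : ℝ) :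
    ‖Complex.exp (u * Complex.I) - (1 + u * Complex.I) * (Real.exp (-(u ^ 2 / 2)) : ℂ)‖
      ≤ 2 * |u| ^ p * ‖1 + (u : ℂ) * Complex.I‖ := by
  have h1 := one_le_norm_one_add_mul_I u
  rcases le_or_gt |u| 1 with hu | hu
  · have hu2 : u ^ 2 ≤ 1 := by rw [← sq_abs]; exact pow_le_one₀ (abs_nonneg u) hu
    have hr1 := Complex.exp_bound (x := u * Complex.I) (by simpa using hu) (n := 3) (by norm_num)
    have hr2 := Real.exp_bound (x := -(u ^ 2 / 2))
      (by rw [abs_neg, abs_of_nonneg (by positivity)]; linarith) (n := 2) (by norm_num)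
    simp only [Finset.sum_range_succ, Finset.sum_range_zero, norm_mul, Complex.norm_real,
      Complex.norm_I, mul_one, Real.norm_eq_abs, Nat.factorial] at hr1 hr2
    norm_num at hr1 hr2
    set r1 : ℂ := Complex.exp (u * Complex.I) - (1 + u * Complex.I + (u * Complex.I) ^ 2 / 2)
    set r2 : ℝ := Real.exp (-(u ^ 2 / 2)) - (1 + -(u ^ 2 / 2))
    have key : Complex.exp (u * Complex.I) - (1 + u * Complex.I) * (Real.exp (-(u ^ 2 / 2)) : ℂ)
        = r1 + (u : ℂ) ^ 3 * Complex.I / 2 - (1 + u * Complex.I) * (r2 : ℂ) := by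
      simp only [r1, r2]
      push_cast
      ring_nf
      simp only [Complex.I_sq]
      ring
    have hcube : |u| ^ 3 ≤ |u| ^ p := by
      rcases eq_or_lt_of_le (abs_nonneg u) with h0 | h0
      · rw [← h0, Real.zero_rpow (by linarith)]; norm_num
      · rw [← Real.rpow_natCast]
        exact Real.rpow_le_rpow_of_exponent_ge h0 hu (by exact_mod_cast hp3)
    have hn : ‖1 + (u : ℂ) * Complex.I‖ ≤ 2 := by
      refine (norm_add_le _ _).trans ?_
      simp only [norm_one, norm_mul, Complex.norm_real, Complex.norm_I, mul_one, Real.norm_eq_abs]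
      linarith
    have h4 : u ^ 4 ≤ |u| ^ 3 := by
      have : u ^ 4 = |u| ^ 3 * |u| := by
        rw [← pow_succ, ← abs_pow]; exact (abs_of_nonneg (by positivity)).symm
      rw [this]
      exact mul_le_of_le_one_right (by positivity) hu
    rw [key]
    calc _ ≤ ‖r1‖ + ‖(u : ℂ) ^ 3 * Complex.I / 2‖ + ‖(1 + u * Complex.I) * (r2 : ℂ)‖ :=
          (norm_sub_le _ _).trans (by gcongr; exact norm_add_le _ _)
      _ ≤ |u| ^ 3 * (2 / 9) + |u| ^ 3 / 2 + 2 * ((u ^ 2 / 2) ^ 2 * (3 / 4)) := by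
          gcongr
          · simp
          · rw [norm_mul]
            gcongr
            rw [Complex.norm_real]
            exact hr2
      _ ≤ 2 * |u| ^ 3 := by
          have : (0 : ℝ) ≤ |u| ^ 3 := by positivity
          nlinarith
      _ ≤ 2 * |u| ^ p * 1 := by linarith
      _ ≤ _ := by gcongr
  · have hp1 : 1 ≤ |u| ^ p := Real.one_le_rpow hu.le (by linarith)
    have he : Real.exp (-(u ^ 2 / 2)) ≤ 1 := Real.exp_le_one_iff.2 (by nlinarith [sq_nonneg u])
    calc _ ≤ ‖Complex.exp (u * Complex.I)‖
            + ‖(1 + u * Complex.I) * (Real.exp (-(u ^ 2 / 2)) : ℂ)‖ := norm_sub_le _ _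
      _ ≤ 1 + ‖1 + (u : ℂ) * Complex.I‖ * 1 := by
          rw [Complex.norm_exp_ofReal_mul_I, norm_mul, Complex.norm_real, Real.norm_eq_abs,
            abs_of_pos (Real.exp_pos _)]
          gcongr
      _ ≤ 2 * 1 * ‖1 + (u : ℂ) * Complex.I‖ := by linarith
      _ ≤ _ := by gcongr

/-- `x j` if the quadratic variation before time `j` is at most `C`, and `0` otherwise. -/
noncomputable def stopped (C : ℝ) (x : ℕ → ℝ) (j : ℕ) : ℝ :=
  if ∑ i ∈ Finset.range j, x i ^ 2 ≤ C then x j else 0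

/-- The product of the factors `1 + i t x_j`, stopped at level `C` of the quadratic variation. -/
noncomputable def stoppedProd (C t : ℝ) (x : ℕ → ℝ) (n : ℕ) : ℂ :=
  ∏ j ∈ Finset.range n, (1 + ((t * stopped C x j : ℝ) : ℂ) * Complex.I)

lemma stoppedProd_succ (C t : ℝ) (x : ℕ → ℝ) (n : ℕ) :
    stoppedProd C t x (n + 1) =
      stoppedProd C t x n * (1 + ((t * stopped C x n : ℝ) : ℂ) * Complex.I) :=
  Finset.prod_range_succ _ _

/-- Each active factor has squared modulus `1 + t² x² ≤ exp (t² x²)`. The stopping test looks only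
at indices strictly before `j`, so the factor that crosses level `C` is still included: it costs the
extra `1 + t² x²`, and all later factors equal one. The first bound feeds the second at the crossing
step. -/
lemma norm_stoppedProd_sq_le_aux (C t : ℝ) (x : ℕ → ℝ) (n : ℕ) :
    (∑ i ∈ Finset.range n, x i ^ 2 ≤ C →
      ‖stoppedProd C t x n‖ ^ 2 ≤ Real.exp (t ^ 2 * ∑ i ∈ Finset.range n, x i ^ 2)) ∧
    (0 ≤ C → ‖stoppedProd C t x n‖ ^ 2
      ≤ Real.exp (t ^ 2 * C) * (1 + t ^ 2 * ∑ i ∈ Finset.range n, x i ^ 2)) := by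
  induction n with
  | zero =>
    simp only [stoppedProd, Finset.range_zero, Finset.prod_empty, Finset.sum_empty]
    refine ⟨fun _ => by simp, fun hC => ?_⟩
    have := Real.one_le_exp (x := t ^ 2 * C) (by positivity)
    simpa using this
  | succ n ih =>
    have hv : ∑ i ∈ Finset.range (n + 1), x i ^ 2 = ∑ i ∈ Finset.range n, x i ^ 2 + x n ^ 2 :=
      Finset.sum_range_succ _ _
    have hv0 : 0 ≤ ∑ i ∈ Finset.range n, x i ^ 2 := Finset.sum_nonneg fun i _ => sq_nonneg _
    rw [stoppedProd_succ, norm_mul, mul_pow, norm_one_add_mul_I_sq, hv]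
    set v := ∑ i ∈ Finset.range n, x i ^ 2
    have hx : 0 ≤ x n ^ 2 := sq_nonneg _
    have ht : 0 ≤ t ^ 2 := sq_nonneg _
    rcases le_or_gt v C with h | h
    · have h1 := ih.1 h
      rw [show stopped C x n = x n from if_pos h, mul_pow]
      refine ⟨fun h' => ?_, fun hC => ?_⟩
      · rw [mul_add (t ^ 2), Real.exp_add]
        gcongr
        linarith [Real.add_one_le_exp (t ^ 2 * x n ^ 2)]
      · gcongr
        · exact h1.trans (Real.exp_le_exp.2 (by gcongr))
        · nlinarith
    · simp only [stopped, v, not_le.2 h, if_false]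
      refine ⟨fun h' => by linarith, fun hC => ?_⟩
      simp only [mul_zero, ne_eq, OfNat.ofNat_ne_zero, not_false_eq_true, zero_pow, add_zero,
        mul_one]
      refine (ih.2 hC).trans ?_
      gcongr
      linarith

lemma norm_stoppedProd_sq_le {C : ℝ} (hC : 0 ≤ C) (t : ℝ) (x : ℕ → ℝ) (n : ℕ) :
    ‖stoppedProd C t x n‖ ^ 2
      ≤ Real.exp (t ^ 2 * C) * (1 + t ^ 2 * ∑ i ∈ Finset.range n, x i ^ 2) :=
  (norm_stoppedProd_sq_le_aux C t x n).2 hC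

lemma norm_stoppedProd_le_of_le {C t : ℝ} {x : ℕ → ℝ} {n : ℕ}
    (h : ∑ i ∈ Finset.range n, x i ^ 2 ≤ C) :
    ‖stoppedProd C t x n‖ ≤ Real.exp (t ^ 2 * C) := by
  have h1 := (norm_stoppedProd_sq_le_aux C t x n).1 h
  have h0 : 0 ≤ C := le_trans (Finset.sum_nonneg fun i _ => sq_nonneg _) h
  have h2 : ‖stoppedProd C t x n‖ ^ 2 ≤ Real.exp (t ^ 2 * C) ^ 2 := by
    refine h1.trans ?_
    rw [← Real.exp_nat_mul]
    refine Real.exp_le_exp.2 ?_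
    have := mul_le_mul_of_nonneg_left h (sq_nonneg t)
    have : 0 ≤ t ^ 2 * C := by positivity
    push_cast
    linarith
  exact le_of_sq_le_sq h2 (Real.exp_pos _).le

lemma stoppedProd_eq_of_le {C t : ℝ} {x : ℕ → ℝ} {n : ℕ}
    (h : ∑ i ∈ Finset.range n, x i ^ 2 ≤ C) :
    stoppedProd C t x n = ∏ j ∈ Finset.range n, (1 + ((t * x j : ℝ) : ℂ) * Complex.I) := by
  refine Finset.prod_congr rfl fun j hj => ?_
  have : ∑ i ∈ Finset.range j, x i ^ 2 ≤ C :=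
    (Finset.sum_le_sum_of_subset_of_nonneg
      (Finset.range_mono (Finset.mem_range.1 hj).le) fun i _ _ => sq_nonneg _).trans h
  rw [stopped, if_pos this]

/-- Replace one factor at a time. The old error is multiplied by a unimodular number, and since `‖1
+ iu‖ ≥ 1` it may be charged to the longer product; the new error is the one-factor estimate times
the previous product. -/
lemma norm_exp_sum_sub_prod_mul_exp_le {p : ℝ} (hp2 : 2 ≤ p) (hp3 : p ≤ 3) (u : ℕ → ℝ) (n : ℕ) :
    ‖Complex.exp (((∑ j ∈ Finset.range n, u j : ℝ) : ℂ) * Complex.I) -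
      (∏ j ∈ Finset.range n, (1 + (u j : ℂ) * Complex.I)) *
        (Real.exp (-((∑ j ∈ Finset.range n, u j ^ 2) / 2)) : ℂ)‖
      ≤ ‖∏ j ∈ Finset.range n, (1 + (u j : ℂ) * Complex.I)‖ *
        (2 * ∑ j ∈ Finset.range n, |u j| ^ p) := by
  induction n with
  | zero => simp
  | succ n ih =>
    simp only [Finset.sum_range_succ, Finset.prod_range_succ]
    set s := ∑ j ∈ Finset.range n, u j
    set v := ∑ j ∈ Finset.range n, u j ^ 2
    set T := ∏ j ∈ Finset.range n, (1 + (u j : ℂ) * Complex.I)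
    set q := ∑ j ∈ Finset.range n, |u j| ^ p
    have hv : 0 ≤ v := Finset.sum_nonneg fun i _ => sq_nonneg _
    have hq : 0 ≤ q := Finset.sum_nonneg fun i _ => by positivity
    have e1 : Complex.exp (((s + u n : ℝ) : ℂ) * Complex.I)
        = Complex.exp (s * Complex.I) * Complex.exp (u n * Complex.I) := by
      rw [← Complex.exp_add]; push_cast; ring_nf
    have e2 : (Real.exp (-((v + u n ^ 2) / 2)) : ℂ)
        = (Real.exp (-(v / 2)) : ℂ) * (Real.exp (-(u n ^ 2 / 2)) : ℂ) := by
      rw [← Complex.ofReal_mul, ← Real.exp_add]; congr 2; ring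
    rw [e1, e2]
    have key : Complex.exp (s * Complex.I) * Complex.exp (u n * Complex.I)
        - T * (1 + u n * Complex.I) * ((Real.exp (-(v / 2)) : ℂ) * (Real.exp (-(u n ^ 2 / 2)) : ℂ))
        = (Complex.exp (s * Complex.I) - T * (Real.exp (-(v / 2)) : ℂ))
            * Complex.exp (u n * Complex.I)
          + T * (Real.exp (-(v / 2)) : ℂ) * (Complex.exp (u n * Complex.I)
            - (1 + u n * Complex.I) * (Real.exp (-(u n ^ 2 / 2)) : ℂ)) := by ring
    have he : Real.exp (-(v / 2)) ≤ 1 := Real.exp_le_one_iff.2 (by linarith)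
    rw [key]
    calc _ ≤ ‖T‖ * (2 * q) * 1 + ‖T‖ * 1 * (2 * |u n| ^ p * ‖1 + (u n : ℂ) * Complex.I‖) := by
          refine (norm_add_le _ _).trans ?_
          rw [norm_mul, norm_mul, norm_mul, Complex.norm_exp_ofReal_mul_I, Complex.norm_real,
            Real.norm_eq_abs, abs_of_pos (Real.exp_pos _)]
          gcongr
          exact norm_exp_sub_one_add_mul_exp_le hp2 hp3 (u n)
      _ ≤ ‖T‖ * (2 * q) * ‖1 + (u n : ℂ) * Complex.I‖
            + ‖T‖ * 1 * (2 * |u n| ^ p * ‖1 + (u n : ℂ) * Complex.I‖) := by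
          gcongr
          exact one_le_norm_one_add_mul_I _
      _ = _ := by rw [norm_mul]; ring

end StoppedProduct

/-! ### Martingale central limit theorem with random limiting variance. -/

section MartingaleCLT

/-- Every subsequence has a further one along which convergence is almost everywhere, and there
dominated convergence applies with bound `(2M)^k`. -/
lemma tendsto_integral_abs_sub_pow {Ω : Type*} {mΩ : MeasurableSpace Ω} {μ : Measure Ω}
    [IsFiniteMeasure μ] {U : ℕ → Ω → ℝ} {Γ : Ω → ℝ} (hU : ∀ n, AEMeasurable (U n) μ)
    (h : TendstoInMeasure μ U atTop Γ) {Φ : ℝ → ℝ} (hΦ : Continuous Φ) {M : ℝ}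
    (hM : ∀ v, |Φ v| ≤ M) {k : ℕ} (hk : k ≠ 0) :
    Tendsto (fun n => ∫ ω, |Φ (U n ω) - Φ (Γ ω)| ^ k ∂μ) atTop (𝓝 0) := by
  have hΓ : AEMeasurable Γ μ := h.aemeasurable hU
  refine tendsto_of_subseq_tendsto fun ns hns => ?_
  obtain ⟨ms, -, hms2⟩ := (h.comp hns).exists_seq_tendsto_ae'
  refine ⟨ms, ?_⟩
  have h0 : ∫ _ : Ω, (0 : ℝ) ∂μ = 0 := integral_zero _ _
  rw [← h0]
  refine tendsto_integral_of_dominated_convergence (fun _ => (2 * M) ^ k) (fun n => ?_)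
    (integrable_const _) (fun n => ae_of_all _ fun ω => ?_) ?_
  · have := hU (ns (ms n))
    have h1 : AEMeasurable (fun ω => Φ (U (ns (ms n)) ω)) μ := hΦ.measurable.comp_aemeasurable this
    have h2 : AEMeasurable (fun ω => Φ (Γ ω)) μ := hΦ.measurable.comp_aemeasurable hΓ
    exact ((h1.sub h2).norm.pow_const k).aestronglyMeasurable
  · rw [Real.norm_eq_abs, abs_pow, abs_abs]
    gcongr
    exact (abs_sub _ _).trans (by linarith [hM (U (ns (ms n)) ω), hM (Γ ω)])
  · filter_upwards [hms2] with ω hω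
    have h1 : Tendsto (fun n => Φ (U (ns (ms n)) ω)) atTop (𝓝 (Φ (Γ ω))) :=
      (hΦ.tendsto _).comp hω
    have h2 := ((h1.sub_const (Φ (Γ ω))).abs).pow k
    simpa [hk] using h2

lemma integral_mul_le_sqrt_mul_sqrt {Ω : Type*} {mΩ : MeasurableSpace Ω} {μ : Measure Ω}
    {f g : Ω → ℝ} (hf0 : 0 ≤ f) (hg0 : 0 ≤ g) (hf : MemLp f 2 μ) (hg : MemLp g 2 μ) :
    ∫ ω, f ω * g ω ∂μ ≤ √(∫ ω, f ω ^ 2 ∂μ) * √(∫ ω, g ω ^ 2 ∂μ) := by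
  have h := integral_mul_le_Lp_mul_Lq_of_nonneg (μ := μ) (p := 2) (q := 2)
    Real.HolderConjugate.two_two (ae_of_all _ hf0) (ae_of_all _ hg0) (by simpa using hf)
    (by simpa using hg)
  simpa [Real.sqrt_eq_rpow] using h

lemma measurable_stopped {Ω : Type*} {m : MeasurableSpace Ω} {x : Ω → ℕ → ℝ} {n : ℕ}
    (hx : ∀ j ≤ n, Measurable fun ω => x ω j) (C : ℝ) :
    Measurable fun ω => stopped C (x ω) n := by
  refine Measurable.ite ?_ (hx n le_rfl) measurable_const
  refine measurableSet_le ?_ measurable_const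
  exact Finset.measurable_fun_sum _ fun j hj => (hx j (Finset.mem_range.1 hj).le).pow_const 2

lemma measurable_stoppedProd {Ω : Type*} {m : MeasurableSpace Ω} {x : Ω → ℕ → ℝ} {n : ℕ}
    (hx : ∀ j < n, Measurable fun ω => x ω j) (C t : ℝ) :
    Measurable fun ω => stoppedProd C t (x ω) n := by
  refine Finset.measurable_fun_prod _ fun j hj => ?_
  have hj' := Finset.mem_range.1 hj
  have := measurable_stopped (fun i hi => hx i (lt_of_le_of_lt hi hj')) C (n := j)
  fun_prop

variable {Ω : Type*} {mΩ : MeasurableSpace Ω} {μ : Measure Ω} [IsProbabilityMeasure μ]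

lemma integral_mul_eq_zero_of_condExp_eq_zero {m : MeasurableSpace Ω} (hm : m ≤ mΩ) {d : Ω → ℝ}
    (hd : Integrable d μ) (hmart : μ[d | m] =ᵐ[μ] 0) {B : Ω → ℂ} (hB : Measurable[m] B) {M : ℝ}
    (hM : ∀ ω, ‖B ω‖ ≤ M) : ∫ ω, B ω * (d ω : ℂ) ∂μ = 0 := by
  have hint : Integrable (fun ω => B ω * (d ω : ℂ)) μ :=
    hd.ofReal.bdd_mul (hB.mono hm le_rfl).aestronglyMeasurable (ae_of_all _ hM)
  -- The pull-out property is applied through a bilinear map because the multiplier is complex while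
  -- `d` is real.
  let L : ℂ →L[ℝ] ℝ →L[ℝ] ℂ := (ContinuousLinearMap.lsmul ℝ ℝ).flip
  have hL (z : ℂ) (r : ℝ) : L z r = z * (r : ℂ) := by
    simp [L, mul_comm]
  have h := condExp_bilin_of_stronglyMeasurable_left L (m := m) (μ := μ) (f := B) (g := d)
    hB.stronglyMeasurable (by simpa only [hL] using hint) hd
  simp only [hL] at h
  rw [← integral_condExp hm, integral_congr_ae (g := fun _ => 0), integral_zero]
  filter_upwards [h, hmart] with ω h1 h2
  rw [h1, h2]
  simp

lemma integrable_norm_stoppedProd_sq {D : ℕ → Ω → ℝ} (hD : ∀ k, Measurable (D k))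
    (hD2 : ∀ k, Integrable (fun ω => D k ω ^ 2) μ) {C : ℝ} (hC : 0 ≤ C) (t c : ℝ) (n : ℕ) :
    Integrable (fun ω => ‖stoppedProd C t (fun j => c * D j ω) n‖ ^ 2) μ := by
  have hm : Measurable fun ω => stoppedProd C t (fun j => c * D j ω) n :=
    measurable_stoppedProd (fun j _ => (hD j).const_mul c) C t
  refine Integrable.mono' (g := fun ω => Real.exp (t ^ 2 * C) *
    (1 + t ^ 2 * ∑ i ∈ Finset.range n, c ^ 2 * D i ω ^ 2)) ?_
    (hm.norm.pow_const 2).aestronglyMeasurable (ae_of_all _ fun ω => ?_)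
  · refine Integrable.const_mul ((integrable_const _).add (Integrable.const_mul ?_ _)) _
    exact integrable_finsetSum _ fun i _ => (hD2 i).const_mul _
  · rw [Real.norm_eq_abs, abs_of_nonneg (by positivity)]
    have := norm_stoppedProd_sq_le hC t (fun j => c * D j ω) n
    simpa only [mul_pow] using this

lemma memLp_stoppedProd {D : ℕ → Ω → ℝ} (hD : ∀ k, Measurable (D k))
    (hD2 : ∀ k, Integrable (fun ω => D k ω ^ 2) μ) {C : ℝ} (hC : 0 ≤ C) (t c : ℝ) (n : ℕ) :
    MemLp (fun ω => stoppedProd C t (fun j => c * D j ω) n) 2 μ := by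
  have hm : Measurable fun ω => stoppedProd C t (fun j => c * D j ω) n :=
    measurable_stoppedProd (fun j _ => (hD j).const_mul c) C t
  exact (memLp_two_iff_integrable_sq_norm hm.aestronglyMeasurable).2
    (integrable_norm_stoppedProd_sq hD hD2 hC t c n)

lemma integral_norm_stoppedProd_sq_le {D : ℕ → Ω → ℝ} (hD : ∀ k, Measurable (D k))
    (hD2 : ∀ k, Integrable (fun ω => D k ω ^ 2) μ) {K : ℝ} (hK : ∀ k, ∫ ω, D k ω ^ 2 ∂μ ≤ K)
    {C : ℝ} (hC : 0 ≤ C) (t : ℝ) (n : ℕ) :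
    ∫ ω, ‖stoppedProd C t (fun j => (√n)⁻¹ * D j ω) n‖ ^ 2 ∂μ
      ≤ Real.exp (t ^ 2 * C) * (1 + t ^ 2 * K) := by
  have hK0 : 0 ≤ K := (integral_nonneg fun ω => sq_nonneg _).trans (hK 0)
  have hi : Integrable (fun ω => ∑ i ∈ Finset.range n, (n : ℝ)⁻¹ * D i ω ^ 2) μ :=
    integrable_finsetSum _ fun i _ => (hD2 i).const_mul _
  calc _ ≤ ∫ ω, Real.exp (t ^ 2 * C) *
          (1 + t ^ 2 * ∑ i ∈ Finset.range n, (n : ℝ)⁻¹ * D i ω ^ 2) ∂μ := by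
        refine integral_mono (integrable_norm_stoppedProd_sq hD hD2 hC t _ n)
          (((integrable_const _).add (hi.const_mul _)).const_mul _) fun ω => ?_
        have := norm_stoppedProd_sq_le hC t (fun j => (√n)⁻¹ * D j ω) n
        simpa only [mul_pow, inv_pow, Real.sq_sqrt (Nat.cast_nonneg n)] using this
    _ = Real.exp (t ^ 2 * C) *
          (1 + t ^ 2 * ∑ i ∈ Finset.range n, (n : ℝ)⁻¹ * ∫ ω, D i ω ^ 2 ∂μ) := by
        rw [integral_const_mul, integral_add (integrable_const _) (hi.const_mul _),
          integral_const_mul, integral_finsetSum _ fun i _ => (hD2 i).const_mul _]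
        simp [integral_const_mul]
    _ ≤ Real.exp (t ^ 2 * C) * (1 + t ^ 2 * ∑ i ∈ Finset.range n, (n : ℝ)⁻¹ * K) := by
        gcongr
        exact hK _
    _ ≤ _ := by
        gcongr
        simp only [Finset.sum_const, Finset.card_range, nsmul_eq_mul, ← mul_assoc]
        -- The inequality `n * n⁻¹ ≤ 1` also covers `n = 0`, where the inverse is zero.
        exact mul_le_of_le_one_left hK0 mul_inv_le_one

/-- The stopped product is a martingale. Its increment at `n` is `D n` times a multiplier supported
on the event that stopping has not yet occurred; this event is known at time `n`, and on it the
product is bounded by `exp (t² C)`, so the conditional mean zero of `D n` applies. -/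
lemma integral_stoppedProd_mul {ℱ : Filtration ℕ mΩ} {D : ℕ → Ω → ℝ}
    (hD : ∀ k, Measurable[ℱ (k + 1)] (D k)) (hD2 : ∀ k, Integrable (fun ω => D k ω ^ 2) μ)
    (hmart : ∀ k, μ[D k | ℱ k] =ᵐ[μ] 0) {C : ℝ} (hC : 0 ≤ C) (t c : ℝ) {m : ℕ} {Y : Ω → ℝ}
    (hY : Measurable[ℱ m] Y) {M : ℝ} (hM : ∀ ω, |Y ω| ≤ M) {n : ℕ} (hmn : m ≤ n) :
    ∫ ω, stoppedProd C t (fun j => c * D j ω) n * (Y ω : ℂ) ∂μ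
      = ∫ ω, stoppedProd C t (fun j => c * D j ω) m * (Y ω : ℂ) ∂μ := by
  have hD' (k : ℕ) : Measurable (D k) := (hD k).mono (ℱ.le _) le_rfl
  have hint (k : ℕ) : Integrable (fun ω => stoppedProd C t (fun j => c * D j ω) k * (Y ω : ℂ)) μ :=
    ((memLp_stoppedProd hD' hD2 hC t c k).integrable one_le_two).mul_bdd (c := M)
      (Complex.measurable_ofReal.comp (hY.mono (ℱ.le _) le_rfl)).aestronglyMeasurable
      (ae_of_all _ fun ω => by simpa using hM ω)
  induction n, hmn using Nat.le_induction with
  | base => rfl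
  | succ n hmn ih =>
    rw [← ih, ← sub_eq_zero, ← integral_sub (hint _) (hint _)]
    have hDn : ∀ j < n, Measurable[ℱ n] fun ω => c * D j ω := fun j hj =>
      ((hD j).mono (ℱ.mono hj) le_rfl).const_mul c
    set S : Set Ω := {ω | ∑ i ∈ Finset.range n, (c * D i ω) ^ 2 ≤ C}
    have hS : MeasurableSet[ℱ n] S :=
      measurableSet_le (Finset.measurable_fun_sum _ fun j hj =>
        (hDn j (Finset.mem_range.1 hj)).pow_const 2) measurable_const
    have hB : Measurable[ℱ n] (S.indicator fun ω =>
        stoppedProd C t (fun j => c * D j ω) n * (Y ω : ℂ) * (((t * c : ℝ) : ℂ) * Complex.I)) := by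
      refine Measurable.indicator ?_ hS
      have h1 : Measurable[ℱ n] fun ω => stoppedProd C t (fun j => c * D j ω) n :=
        measurable_stoppedProd hDn C t
      have h2 : Measurable[ℱ n] fun ω => (Y ω : ℂ) :=
        Complex.measurable_ofReal.comp (hY.mono (ℱ.mono hmn) le_rfl)
      exact (h1.mul h2).mul_const _
    have hd : Integrable (D n) μ :=
      ((memLp_two_iff_integrable_sq (hD' n).aestronglyMeasurable).2 (hD2 n)).integrable one_le_two
    have h0 := integral_mul_eq_zero_of_condExp_eq_zero (ℱ.le n) hd (hmart n) hB
      (M := Real.exp (t ^ 2 * C) * M * |t * c|) (fun ω => by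
        have hM0 : 0 ≤ M := (abs_nonneg _).trans (hM ω)
        by_cases hω : ω ∈ S
        · rw [Set.indicator_of_mem hω]
          simp only [norm_mul, Complex.norm_real, Complex.norm_I, mul_one, Real.norm_eq_abs,
            abs_mul]
          gcongr
          · exact norm_stoppedProd_le_of_le hω
          · exact hM ω
        · rw [Set.indicator_of_notMem hω, norm_zero]
          positivity)
    rw [← h0]
    refine integral_congr_ae (ae_of_all _ fun ω => ?_)
    simp only [stoppedProd_succ]
    by_cases hω : ω ∈ S
    · rw [Set.indicator_of_mem hω, show stopped C (fun j => c * D j ω) n = c * D n ω from if_pos hω]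
      push_cast
      ring
    · rw [Set.indicator_of_notMem hω, show stopped C (fun j => c * D j ω) n = 0 from if_neg hω]
      simp

lemma tendsto_stoppedProd_inv_sqrt (C t : ℝ) (d : ℕ → ℝ) (m : ℕ) :
    Tendsto (fun n : ℕ => stoppedProd C t (fun j => (√n)⁻¹ * d j) m) atTop (𝓝 1) := by
  have h0 : Tendsto (fun n : ℕ => (√(n : ℝ))⁻¹) atTop (𝓝 0) :=
    tendsto_inv_atTop_zero.comp (Real.tendsto_sqrt_atTop.comp tendsto_natCast_atTop_atTop)
  have h1 (j : ℕ) : Tendsto (fun n : ℕ => t * stopped C (fun j => (√n)⁻¹ * d j) j) atTop (𝓝 0) := by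
    -- Whether index `j` is stopped may change with `n`, but stopping only decreases the absolute
    -- value.
    have h2 : Tendsto (fun n : ℕ => |t| * ((√(n : ℝ))⁻¹ * |d j|)) atTop (𝓝 0) := by
      simpa using (h0.mul_const |d j|).const_mul |t|
    refine squeeze_zero_norm (fun n => ?_) h2
    rw [norm_mul, Real.norm_eq_abs, Real.norm_eq_abs]
    gcongr
    rw [stopped]
    split_ifs
    · rw [abs_mul, abs_of_nonneg (by positivity : 0 ≤ (√(n : ℝ))⁻¹)]
    · rw [abs_zero]; positivity
  have h3 := tendsto_finsetProd (Finset.range m) fun j _ =>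
    (((Complex.continuous_ofReal.tendsto 0).comp (h1 j)).mul_const Complex.I).const_add 1
  simpa [stoppedProd] using h3

/-- Against a variable known at time `m`, the martingale property replaces the product of length `n`
by that of length `m`, whose factors all tend to one. As `Γ` is a limit of such variables, the
uniform L² bound transfers the conclusion to `Φ Γ`; no measurability of `Γ` with respect to a fixed
stage of the filtration is needed. -/
lemma tendsto_integral_stoppedProd_sub_one_mul {ℱ : Filtration ℕ mΩ} {D : ℕ → Ω → ℝ}
    (hD : ∀ k, Measurable[ℱ (k + 1)] (D k)) (hD2 : ∀ k, Integrable (fun ω => D k ω ^ 2) μ)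
    (hmart : ∀ k, μ[D k | ℱ k] =ᵐ[μ] 0) {K : ℝ} (hK : ∀ k, ∫ ω, D k ω ^ 2 ∂μ ≤ K) {Γ : Ω → ℝ}
    (hΓ : TendstoInMeasure μ (fun (n : ℕ) ω => (n : ℝ)⁻¹ * ∑ k ∈ Finset.range n, D k ω ^ 2) atTop Γ)
    {C : ℝ} (hC : 0 ≤ C) (t : ℝ) {Φ : ℝ → ℝ} (hΦ : Continuous Φ) {M : ℝ} (hM : ∀ v, |Φ v| ≤ M) :
    Tendsto (fun n : ℕ =>
      ∫ ω, (stoppedProd C t (fun j => (√n)⁻¹ * D j ω) n - 1) * (Φ (Γ ω) : ℂ) ∂μ) atTop (𝓝 0) := by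
  have hD' (k : ℕ) : Measurable (D k) := (hD k).mono (ℱ.le _) le_rfl
  set U : ℕ → Ω → ℝ := fun n ω => (n : ℝ)⁻¹ * ∑ k ∈ Finset.range n, D k ω ^ 2
  have hUℱ (n : ℕ) : Measurable[ℱ n] (U n) :=
    (Finset.measurable_fun_sum _ fun j hj =>
      ((hD j).mono (ℱ.mono (Finset.mem_range.1 hj)) le_rfl).pow_const 2).const_mul _
  have hU (n : ℕ) : Measurable (U n) := (hUℱ n).mono (ℱ.le _) le_rfl
  have hΓm : AEMeasurable Γ μ := hΓ.aemeasurable fun n => (hU n).aemeasurable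
  have hM0 : 0 ≤ M := (abs_nonneg _).trans (hM 0)
  set T : ℕ → ℕ → Ω → ℂ := fun n k ω => stoppedProd C t (fun j => (√n)⁻¹ * D j ω) k
  have hTm (n k : ℕ) : Measurable (T n k) :=
    measurable_stoppedProd (fun j _ => (hD' j).const_mul _) C t
  have hTL (n k : ℕ) : MemLp (T n k) 2 μ := memLp_stoppedProd hD' hD2 hC t _ k
  have hδ := tendsto_integral_abs_sub_pow (fun n => (hU n).aemeasurable) hΓ hΦ hM two_ne_zero
  have hΦm (m : ℕ) : Measurable fun ω => (Φ (U m ω) : ℂ) :=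
    Complex.measurable_ofReal.comp (hΦ.measurable.comp (hU m))
  have hΦΓ : AEMeasurable (fun ω => (Φ (Γ ω) : ℂ)) μ :=
    Complex.measurable_ofReal.comp_aemeasurable (hΦ.measurable.comp_aemeasurable hΓm)
  -- the approximation of `Φ Γ` by `Φ (U m)`
  obtain ⟨R, hR⟩ : ∃ R : ℝ, ∀ n m, ‖∫ ω, (T n n ω - 1) * ((Φ (Γ ω) : ℂ) - Φ (U m ω)) ∂μ‖
      ≤ R * √(∫ ω, |Φ (U m ω) - Φ (Γ ω)| ^ 2 ∂μ) := by
    -- Cauchy–Schwarz with `‖T - 1‖² ≤ 2‖T‖² + 2` and the L² bound on the stopped product; the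
    -- constant depends on neither `n` nor `m`.
    refine ⟨√(2 * (Real.exp (t ^ 2 * C) * (1 + t ^ 2 * K)) + 2), fun n m => ?_⟩
    have hF : MemLp (fun ω => ‖T n n ω - 1‖) 2 μ := ((hTL n n).sub (memLp_const 1)).norm
    have hG : MemLp (fun ω => |Φ (U m ω) - Φ (Γ ω)|) 2 μ := by
      refine MemLp.of_bound ?_ (2 * M) (ae_of_all _ fun ω => ?_)
      · exact ((hΦ.measurable.comp_aemeasurable (hU m).aemeasurable).sub
          (hΦ.measurable.comp_aemeasurable hΓm)).norm.aestronglyMeasurable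
      · rw [Real.norm_eq_abs, abs_abs]
        exact (abs_sub _ _).trans (by linarith [hM (U m ω), hM (Γ ω)])
    calc _ ≤ ∫ ω, ‖T n n ω - 1‖ * |Φ (U m ω) - Φ (Γ ω)| ∂μ := by
          refine (norm_integral_le_integral_norm _).trans_eq (integral_congr_ae
            (ae_of_all _ fun ω => ?_))
          simp only [norm_mul]
          rw [← Complex.ofReal_sub, Complex.norm_real, Real.norm_eq_abs, abs_sub_comm]
      _ ≤ √(∫ ω, ‖T n n ω - 1‖ ^ 2 ∂μ) * √(∫ ω, |Φ (U m ω) - Φ (Γ ω)| ^ 2 ∂μ) :=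
          integral_mul_le_sqrt_mul_sqrt (fun ω => norm_nonneg _) (fun ω => abs_nonneg _) hF hG
      _ ≤ _ := by
          gcongr
          calc _ ≤ ∫ ω, (2 * ‖T n n ω‖ ^ 2 + 2) ∂μ := by
                refine integral_mono hF.integrable_sq
                  (((integrable_norm_stoppedProd_sq hD' hD2 hC t _ n).const_mul 2).add
                    (integrable_const _)) fun ω => ?_
                have h1 : ‖T n n ω - 1‖ ≤ ‖T n n ω‖ + 1 := by
                  simpa using norm_sub_le (T n n ω) 1
                have h2 := norm_nonneg (T n n ω - 1)
                simp only
                nlinarith [sq_nonneg (‖T n n ω‖ - 1)]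
            _ = 2 * ∫ ω, ‖T n n ω‖ ^ 2 ∂μ + 2 := by
                rw [integral_add ((integrable_norm_stoppedProd_sq hD' hD2 hC t _ n).const_mul 2)
                  (integrable_const _), integral_const_mul]
                simp [T]
            _ ≤ _ := by
                gcongr
                exact integral_norm_stoppedProd_sq_le hD' hD2 hK hC t n
  have hlim (m : ℕ) : Tendsto (fun n => ∫ ω, (T n n ω - 1) * (Φ (U m ω) : ℂ) ∂μ) atTop (𝓝 0) := by
    have h1 : Tendsto (fun n => ∫ ω, (T n m ω - 1) * (Φ (U m ω) : ℂ) ∂μ) atTop (𝓝 0) := by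
      have h0 : ∫ _ : Ω, (0 : ℂ) ∂μ = 0 := integral_zero _ _
      rw [← h0]
      refine tendsto_integral_of_dominated_convergence (fun ω => (Real.exp (t ^ 2 * C) *
        (1 + t ^ 2 * ∑ i ∈ Finset.range m, D i ω ^ 2) + 2) * M)
        (fun n => (((hTm n m).sub_const 1).mul (hΦm m)).aestronglyMeasurable) ?_
        (fun n => ae_of_all _ fun ω => ?_) (ae_of_all _ fun ω => ?_)
      · refine Integrable.mul_const (Integrable.add (Integrable.const_mul ((integrable_const _).add
          (Integrable.const_mul ?_ _)) _) (integrable_const _)) _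
        exact integrable_finsetSum _ fun i _ => hD2 i
      · rw [norm_mul, Complex.norm_real]
        refine mul_le_mul ?_ (hM _) (abs_nonneg _) (by positivity)
        have h1 : ‖T n m ω - 1‖ ≤ ‖T n m ω‖ + 1 := by
          simpa using norm_sub_le (T n m ω) 1
        have h2 : ‖T n m ω‖ ≤ ‖T n m ω‖ ^ 2 + 1 := by nlinarith [sq_nonneg (‖T n m ω‖ - 1)]
        have h3 : ‖T n m ω‖ ^ 2 ≤ _ := norm_stoppedProd_sq_le hC t (fun j => (√n)⁻¹ * D j ω) m
        have h4 : Real.exp (t ^ 2 * C) * (1 + t ^ 2 * ∑ i ∈ Finset.range m, ((√n)⁻¹ * D i ω) ^ 2)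
            ≤ Real.exp (t ^ 2 * C) * (1 + t ^ 2 * ∑ i ∈ Finset.range m, D i ω ^ 2) := by
          refine mul_le_mul_of_nonneg_left (add_le_add_right (mul_le_mul_of_nonneg_left
            (Finset.sum_le_sum fun i _ => ?_) (sq_nonneg t)) 1) (Real.exp_pos _).le
          rw [mul_pow, inv_pow, Real.sq_sqrt (Nat.cast_nonneg n)]
          exact mul_le_of_le_one_left (sq_nonneg _) (Nat.cast_inv_le_one n)
        linarith
      · simpa using ((tendsto_stoppedProd_inv_sqrt C t (fun j => D j ω) m).sub_const 1).mul_const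
          (Φ (U m ω) : ℂ)
    refine h1.congr' ?_
    filter_upwards [eventually_ge_atTop m] with n hn
    have hY : Measurable[ℱ m] fun ω => Φ (U m ω) := hΦ.measurable.comp (hUℱ m)
    have hΦi : Integrable (fun ω => (Φ (U m ω) : ℂ)) μ :=
      Integrable.of_bound (hΦm m).aestronglyMeasurable M
        (ae_of_all _ fun ω => by simpa using hM (U m ω))
    have hi (k : ℕ) : Integrable (fun ω => T n k ω * (Φ (U m ω) : ℂ)) μ :=
      ((hTL n k).integrable one_le_two).mul_bdd (c := M) (hΦm m).aestronglyMeasurable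
        (ae_of_all _ fun ω => by simpa using hM (U m ω))
    have h := integral_stoppedProd_mul hD hD2 hmart hC t (√n)⁻¹ hY (fun ω => hM _) hn
    simp only [sub_mul, one_mul]
    rw [integral_sub (hi m) hΦi, integral_sub (hi n) hΦi, h]
  have hR' : Tendsto (fun m => R * √(∫ ω, |Φ (U m ω) - Φ (Γ ω)| ^ 2 ∂μ)) atTop (𝓝 0) := by
    simpa using ((Real.continuous_sqrt.tendsto 0).comp hδ).const_mul R
  rw [Metric.tendsto_nhds]
  intro ε hε
  -- The stage `m` is fixed first, uniformly in `n`; only then does `n` grow.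
  obtain ⟨m, hm⟩ := (hR'.eventually (gt_mem_nhds (half_pos hε))).exists
  filter_upwards [(Metric.tendsto_nhds.1 (hlim m)) (ε / 2) (half_pos hε)] with n hn
  rw [dist_zero_right] at hn ⊢
  have hi1 : Integrable (fun ω => (T n n ω - 1) * ((Φ (Γ ω) : ℂ) - Φ (U m ω))) μ := by
    refine (((hTL n n).integrable one_le_two).sub (integrable_const 1)).mul_bdd (c := M + M)
      (hΦΓ.sub (hΦm m).aemeasurable).aestronglyMeasurable (ae_of_all _ fun ω => ?_)
    exact (norm_sub_le _ _).trans (add_le_add (by simpa using hM (Γ ω)) (by simpa using hM (U m ω)))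
  have hi2 : Integrable (fun ω => (T n n ω - 1) * (Φ (U m ω) : ℂ)) μ :=
    (((hTL n n).integrable one_le_two).sub (integrable_const 1)).mul_bdd (c := M)
      (hΦm m).aestronglyMeasurable (ae_of_all _ fun ω => by simpa using hM (U m ω))
  have hsplit : ∫ ω, (T n n ω - 1) * (Φ (Γ ω) : ℂ) ∂μ
      = ∫ ω, (T n n ω - 1) * ((Φ (Γ ω) : ℂ) - Φ (U m ω)) ∂μ
        + ∫ ω, (T n n ω - 1) * (Φ (U m ω) : ℂ) ∂μ := by
    rw [← integral_add hi1 hi2]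
    congr 1
    ext ω
    ring
  calc _ ≤ _ := (congrArg norm hsplit).le.trans (norm_add_le _ _)
    _ < ε / 2 + ε / 2 := add_lt_add ((hR n m).trans_lt hm) hn
    _ = ε := add_halves ε

/-- The continuous cutoff equal to `1` below `C - 1` and to `0` above `C`. -/
noncomputable def cutoff (C v : ℝ) : ℝ := max 0 (min 1 (C - v))

lemma continuous_cutoff (C : ℝ) : Continuous (cutoff C) := by
  unfold cutoff; fun_prop

lemma cutoff_nonneg (C v : ℝ) : 0 ≤ cutoff C v := le_max_left _ _

lemma cutoff_le_one (C v : ℝ) : cutoff C v ≤ 1 := max_le zero_le_one (min_le_left _ _)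

lemma abs_cutoff_le (C v : ℝ) : |cutoff C v| ≤ 1 := by
  rw [abs_of_nonneg (cutoff_nonneg C v)]; exact cutoff_le_one C v

lemma cutoff_eq_zero {C v : ℝ} (h : C ≤ v) : cutoff C v = 0 :=
  max_eq_left ((min_le_right _ _).trans (by linarith))

lemma tendsto_cutoff_natCast (v : ℝ) : Tendsto (fun N : ℕ => cutoff N v) atTop (𝓝 1) := by
  refine tendsto_const_nhds.congr' ?_
  filter_upwards [tendsto_natCast_atTop_atTop.eventually_ge_atTop (v + 1)] with N hN
  rw [cutoff, min_eq_left (by linarith), max_eq_right zero_le_one]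

/-- The characteristic function at `t` of a centered Gaussian law of variance `|v|`. -/
noncomputable def gaussWeight (t v : ℝ) : ℝ := Real.exp (-(t ^ 2 * |v| / 2))

lemma continuous_gaussWeight (t : ℝ) : Continuous (gaussWeight t) := by
  unfold gaussWeight; fun_prop

lemma abs_gaussWeight_le (t v : ℝ) : |gaussWeight t v| ≤ 1 := by
  rw [gaussWeight, abs_of_pos (Real.exp_pos _)]
  exact Real.exp_le_one_iff.2 (by linarith [mul_nonneg (sq_nonneg t) (abs_nonneg v)])

/-- If the quadratic variation is at most `C`, stopping never acts and the unstopped product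
estimate holds. Otherwise the cutoff vanishes at the quadratic variation, so its value at `G` is
itself the difference of two cutoff values, which is small when `G` is the limit. -/
lemma norm_exp_sub_stoppedProd_mul_le {p : ℝ} (hp2 : 2 ≤ p) (hp3 : p ≤ 3) (C t : ℝ)
    (x : ℕ → ℝ) (n : ℕ) (G : ℝ) :
    ‖(Complex.exp (((t * ∑ j ∈ Finset.range n, x j : ℝ) : ℂ) * Complex.I)
        - stoppedProd C t x n * (gaussWeight t G : ℂ)) * (cutoff C G : ℂ)‖
      ≤ Real.exp (t ^ 2 * C) * (2 * ∑ j ∈ Finset.range n, |t * x j| ^ p)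
        + Real.exp (t ^ 2 * C)
          * |gaussWeight t (∑ j ∈ Finset.range n, x j ^ 2) - gaussWeight t G|
        + (1 + ‖stoppedProd C t x n‖)
          * |cutoff C (∑ j ∈ Finset.range n, x j ^ 2) - cutoff C G| := by
  set a := ∑ j ∈ Finset.range n, x j ^ 2
  set T := stoppedProd C t x n
  set e := Complex.exp (((t * ∑ j ∈ Finset.range n, x j : ℝ) : ℂ) * Complex.I)
  have ha : 0 ≤ a := Finset.sum_nonneg fun i _ => sq_nonneg _
  have hq : 0 ≤ ∑ j ∈ Finset.range n, |t * x j| ^ p := Finset.sum_nonneg fun i _ => by positivity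
  have he : ‖e‖ = 1 := Complex.norm_exp_ofReal_mul_I _
  have h3 : 0 ≤ (1 + ‖T‖) * |cutoff C a - cutoff C G| := by positivity
  rw [norm_mul, Complex.norm_real, Real.norm_eq_abs]
  rcases le_or_gt a C with h | h
  · have hTe := norm_stoppedProd_le_of_le (t := t) h
    have hexp := norm_exp_sum_sub_prod_mul_exp_le hp2 hp3 (fun j => t * x j) n
    have hsum : ∑ j ∈ Finset.range n, (t * x j) ^ 2 = t ^ 2 * a := by
      simp only [mul_pow, a, Finset.mul_sum]
    rw [← stoppedProd_eq_of_le h, ← Finset.mul_sum, hsum,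
      show Real.exp (-(t ^ 2 * a / 2)) = gaussWeight t a by rw [gaussWeight, abs_of_nonneg ha]]
      at hexp
    have hsplit : e - T * (gaussWeight t G : ℂ) = (e - T * (gaussWeight t a : ℂ))
        + T * ((gaussWeight t a - gaussWeight t G : ℝ) : ℂ) := by push_cast; ring
    calc _ ≤ ‖e - T * (gaussWeight t G : ℂ)‖ * 1 := by gcongr; exact abs_cutoff_le C G
      _ ≤ ‖e - T * (gaussWeight t a : ℂ)‖ + ‖T‖ * |gaussWeight t a - gaussWeight t G| := by
          rw [mul_one, hsplit]
          refine (norm_add_le _ _).trans_eq ?_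
          rw [norm_mul, Complex.norm_real, Real.norm_eq_abs]
      _ ≤ ‖T‖ * (2 * ∑ j ∈ Finset.range n, |t * x j| ^ p)
            + ‖T‖ * |gaussWeight t a - gaussWeight t G| := by gcongr
      _ ≤ Real.exp (t ^ 2 * C) * (2 * ∑ j ∈ Finset.range n, |t * x j| ^ p)
            + Real.exp (t ^ 2 * C) * |gaussWeight t a - gaussWeight t G| := by gcongr
      _ ≤ _ := by linarith
  · rw [cutoff_eq_zero h.le, zero_sub, abs_neg]
    calc _ ≤ (1 + ‖T‖) * |cutoff C G| := by
          gcongr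
          refine (norm_sub_le _ _).trans ?_
          rw [he, norm_mul, Complex.norm_real, Real.norm_eq_abs]
          gcongr
          exact mul_le_of_le_one_right (norm_nonneg _) (abs_gaussWeight_le t G)
      _ ≤ _ := by
          have : 0 ≤ Real.exp (t ^ 2 * C) * (2 * ∑ j ∈ Finset.range n, |t * x j| ^ p)
            + Real.exp (t ^ 2 * C) * |gaussWeight t a - gaussWeight t G| := by positivity
          linarith

/-- Lyapunov's condition: `n` terms of size `n ^ (-p/2)` add up to `n ^ (1 - p/2)`, which vanishes
because `p > 2`. -/
lemma tendsto_integral_sum_abs_rpow {Ω : Type*} {mΩ : MeasurableSpace Ω} {μ : Measure Ω}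
    {D : ℕ → Ω → ℝ} {p : ℝ} (hp : 2 < p)
    (hDp : ∀ k, Integrable (fun ω => |D k ω| ^ p) μ) {K : ℝ} (hK : ∀ k, ∫ ω, |D k ω| ^ p ∂μ ≤ K)
    (t : ℝ) :
    Tendsto (fun n : ℕ => ∫ ω, ∑ j ∈ Finset.range n, |t * ((√n)⁻¹ * D j ω)| ^ p ∂μ) atTop
      (𝓝 0) := by
  have hlim : Tendsto (fun n : ℕ => |t| ^ p * K * (n : ℝ) ^ (-(p / 2 - 1))) atTop (𝓝 0) := by
    simpa using ((tendsto_rpow_neg_atTop (by linarith : 0 < p / 2 - 1)).comp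
      tendsto_natCast_atTop_atTop).const_mul (|t| ^ p * K)
  refine squeeze_zero' (Eventually.of_forall fun n => integral_nonneg fun ω =>
    Finset.sum_nonneg fun i _ => by positivity) ?_ hlim
  filter_upwards [eventually_gt_atTop 0] with n hn
  have hn' : (0 : ℝ) < n := by exact_mod_cast hn
  have heq (j : ℕ) (ω : Ω) : |t * ((√n)⁻¹ * D j ω)| ^ p
      = |t| ^ p * (n : ℝ) ^ (-(p / 2)) * |D j ω| ^ p := by
    rw [abs_mul, abs_mul, Real.mul_rpow (abs_nonneg _) (by positivity),
      Real.mul_rpow (abs_nonneg _) (abs_nonneg _),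
      abs_of_nonneg (by positivity : 0 ≤ (√(n : ℝ))⁻¹), ← mul_assoc]
    congr 2
    rw [Real.sqrt_eq_rpow, ← Real.rpow_neg hn'.le, ← Real.rpow_mul hn'.le]
    congr 1
    ring
  simp only [heq]
  rw [integral_finsetSum _ fun j _ => (hDp j).const_mul _]
  simp only [integral_const_mul]
  calc _ ≤ ∑ j ∈ Finset.range n, |t| ^ p * (n : ℝ) ^ (-(p / 2)) * K := by
        gcongr with j _
        exact hK j
    _ = _ := by
        rw [Finset.sum_const, Finset.card_range, nsmul_eq_mul,
          show -(p / 2 - 1) = -(p / 2) + 1 by ring, Real.rpow_add hn', Real.rpow_one]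
        ring

/-- Integrates the preceding pointwise bound. Beyond level `C` the product is controlled only in L²,
so its term goes through Cauchy–Schwarz. -/
lemma norm_integral_le_of_norm_le_add {f T : Ω → ℂ} {q b c : Ω → ℝ} {A R : ℝ} (hq : Integrable q μ)
    (hb : Integrable b μ) (hc0 : 0 ≤ c) (hc : MemLp c 2 μ) (hT : MemLp T 2 μ)
    (hR : ∫ ω, ‖T ω‖ ^ 2 ∂μ ≤ R)
    (hf : ∀ ω, ‖f ω‖ ≤ A * (2 * q ω) + A * b ω + (1 + ‖T ω‖) * c ω) :
    ‖∫ ω, f ω ∂μ‖ ≤ A * (2 * ∫ ω, q ω ∂μ) + A * ∫ ω, b ω ∂μ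
      + √(2 * R + 2) * √(∫ ω, c ω ^ 2 ∂μ) := by
  have hT1 : MemLp (fun ω => 1 + ‖T ω‖) 2 μ := (memLp_const (1 : ℝ)).add hT.norm
  have hT2 : Integrable (fun ω => ‖T ω‖ ^ 2) μ := hT.norm.integrable_sq
  have hi1 : Integrable (fun ω => A * (2 * q ω)) μ := (hq.const_mul 2).const_mul A
  have hi2 : Integrable (fun ω => A * b ω) μ := hb.const_mul A
  have hi3 : Integrable (fun ω => (1 + ‖T ω‖) * c ω) μ := by
    have := hT1.integrable_mul hc
    simpa only [Pi.mul_def] using this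
  have hi12 : Integrable (fun ω => A * (2 * q ω) + A * b ω) μ := hi1.add hi2
  calc _ ≤ ∫ ω, (A * (2 * q ω) + A * b ω + (1 + ‖T ω‖) * c ω) ∂μ :=
        norm_integral_le_of_norm_le (hi12.add hi3) (ae_of_all _ hf)
    _ = A * (2 * ∫ ω, q ω ∂μ) + A * ∫ ω, b ω ∂μ + ∫ ω, (1 + ‖T ω‖) * c ω ∂μ := by
        rw [integral_add hi12 hi3, integral_add hi1 hi2, integral_const_mul, integral_const_mul,
          integral_const_mul]
    _ ≤ A * (2 * ∫ ω, q ω ∂μ) + A * ∫ ω, b ω ∂μ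
          + √(∫ ω, (1 + ‖T ω‖) ^ 2 ∂μ) * √(∫ ω, c ω ^ 2 ∂μ) := by
        gcongr
        exact integral_mul_le_sqrt_mul_sqrt (fun ω => by positivity) hc0 hT1 hc
    _ ≤ _ := by
        gcongr
        calc _ ≤ ∫ ω, (2 * ‖T ω‖ ^ 2 + 2) ∂μ := by
              refine integral_mono hT1.integrable_sq ((hT2.const_mul 2).add (integrable_const _))
                fun ω => ?_
              simp only
              nlinarith [sq_nonneg (‖T ω‖ - 1)]
          _ = 2 * ∫ ω, ‖T ω‖ ^ 2 ∂μ + 2 := by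
              rw [integral_add (hT2.const_mul 2) (integrable_const _), integral_const_mul]
              simp
          _ ≤ _ := by gcongr

lemma tendsto_integral_exp_sub_stoppedProd_mul {D : ℕ → Ω → ℝ} (hD : ∀ k, Measurable (D k))
    (hD2 : ∀ k, Integrable (fun ω => D k ω ^ 2) μ) {K₂ : ℝ} (hK2 : ∀ k, ∫ ω, D k ω ^ 2 ∂μ ≤ K₂)
    {p : ℝ} (hp2 : 2 < p) (hp3 : p ≤ 3)
    (hDp : ∀ k, Integrable (fun ω => |D k ω| ^ p) μ) {K : ℝ} (hK : ∀ k, ∫ ω, |D k ω| ^ p ∂μ ≤ K)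
    {Γ : Ω → ℝ}
    (hΓ : TendstoInMeasure μ (fun (n : ℕ) ω => (n : ℝ)⁻¹ * ∑ k ∈ Finset.range n, D k ω ^ 2) atTop Γ)
    {C : ℝ} (hC : 0 ≤ C) (t : ℝ) :
    Tendsto (fun n : ℕ => ∫ ω,
      (Complex.exp (((t * ((√n)⁻¹ * ∑ k ∈ Finset.range n, D k ω) : ℝ) : ℂ) * Complex.I)
        - stoppedProd C t (fun j => (√n)⁻¹ * D j ω) n * (gaussWeight t (Γ ω) : ℂ))
          * (cutoff C (Γ ω) : ℂ) ∂μ) atTop (𝓝 0) := by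
  set U : ℕ → Ω → ℝ := fun n ω => (n : ℝ)⁻¹ * ∑ k ∈ Finset.range n, D k ω ^ 2
  have hU (n : ℕ) : Measurable (U n) :=
    (Finset.measurable_fun_sum _ fun j hj => (hD j).pow_const 2).const_mul _
  have hΓm : AEMeasurable Γ μ := hΓ.aemeasurable fun n => (hU n).aemeasurable
  have hUs (n : ℕ) (ω : Ω) : ∑ j ∈ Finset.range n, ((√n)⁻¹ * D j ω) ^ 2 = U n ω := by
    simp only [mul_pow, inv_pow, Real.sq_sqrt (Nat.cast_nonneg n), ← Finset.mul_sum, U]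
  have hb1 := tendsto_integral_sum_abs_rpow hp2 hDp hK t
  have hb2 := tendsto_integral_abs_sub_pow (fun n => (hU n).aemeasurable) hΓ
    (continuous_gaussWeight t) (abs_gaussWeight_le t) one_ne_zero
  have hb3 := tendsto_integral_abs_sub_pow (fun n => (hU n).aemeasurable) hΓ
    (continuous_cutoff C) (abs_cutoff_le C) two_ne_zero
  simp only [pow_one] at hb2
  have hb : Tendsto (fun n : ℕ => Real.exp (t ^ 2 * C) *
        (2 * ∫ ω, ∑ j ∈ Finset.range n, |t * ((√n)⁻¹ * D j ω)| ^ p ∂μ)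
      + Real.exp (t ^ 2 * C) * ∫ ω, |gaussWeight t (U n ω) - gaussWeight t (Γ ω)| ∂μ
      + √(2 * (Real.exp (t ^ 2 * C) * (1 + t ^ 2 * K₂)) + 2) *
        √(∫ ω, |cutoff C (U n ω) - cutoff C (Γ ω)| ^ 2 ∂μ)) atTop (𝓝 0) := by
    have h3 := (((Real.continuous_sqrt.tendsto 0).comp hb3)).const_mul
      (√(2 * (Real.exp (t ^ 2 * C) * (1 + t ^ 2 * K₂)) + 2))
    have := (((hb1.const_mul 2).const_mul (Real.exp (t ^ 2 * C))).add
      (hb2.const_mul (Real.exp (t ^ 2 * C)))).add h3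
    simpa using this
  refine squeeze_zero_norm (fun n => ?_) hb
  have hi1 : Integrable (fun ω => ∑ j ∈ Finset.range n, |t * ((√n)⁻¹ * D j ω)| ^ p) μ := by
    refine integrable_finsetSum _ fun j _ => ?_
    have : (fun ω => |t * ((√n)⁻¹ * D j ω)| ^ p) = fun ω => |t * (√n)⁻¹| ^ p * |D j ω| ^ p := by
      ext ω
      rw [← mul_assoc, abs_mul, Real.mul_rpow (abs_nonneg _) (abs_nonneg _)]
    rw [this]
    exact (hDp j).const_mul _
  have hmem {Φ : ℝ → ℝ} (hΦ : Continuous Φ) (hM : ∀ v, |Φ v| ≤ 1) :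
      MemLp (fun ω => |Φ (U n ω) - Φ (Γ ω)|) 2 μ := by
    refine MemLp.of_bound ?_ 2 (ae_of_all _ fun ω => ?_)
    · exact ((hΦ.measurable.comp_aemeasurable (hU n).aemeasurable).sub
        (hΦ.measurable.comp_aemeasurable hΓm)).norm.aestronglyMeasurable
    · rw [Real.norm_eq_abs, abs_abs]
      exact (abs_sub _ _).trans (by linarith [hM (U n ω), hM (Γ ω)])
  have hi2 := (hmem (continuous_gaussWeight t) (abs_gaussWeight_le t)).integrable one_le_two
  have hc2 := hmem (continuous_cutoff C) (abs_cutoff_le C)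
  refine norm_integral_le_of_norm_le_add hi1 hi2 (fun ω => abs_nonneg _) hc2
    (memLp_stoppedProd hD hD2 hC t _ n) (integral_norm_stoppedProd_sq_le hD hD2 hK2 hC t n)
    fun ω => ?_
  have := norm_exp_sub_stoppedProd_mul_le hp2.le hp3 C t (fun j => (√n)⁻¹ * D j ω) n (Γ ω)
  rw [hUs, ← Finset.mul_sum] at this
  exact this

/-- **Martingale central limit theorem** with a random limiting quadratic variation, under a
uniform moment bound of order `p > 2`, in terms of characteristic functions. -/
theorem tendsto_integral_exp_martingale {ℱ : Filtration ℕ mΩ} {D : ℕ → Ω → ℝ}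
    (hD : ∀ k, Measurable[ℱ (k + 1)] (D k)) (hmart : ∀ k, μ[D k | ℱ k] =ᵐ[μ] 0)
    {p : ℝ} (hp2 : 2 < p) (hp3 : p ≤ 3)
    (hDp : ∀ k, Integrable (fun ω => |D k ω| ^ p) μ) {K : ℝ} (hK : ∀ k, ∫ ω, |D k ω| ^ p ∂μ ≤ K)
    {Γ : Ω → ℝ}
    (hΓ : TendstoInMeasure μ (fun (n : ℕ) ω => (n : ℝ)⁻¹ * ∑ k ∈ Finset.range n, D k ω ^ 2) atTop Γ)
    (t : ℝ) :
    Tendsto (fun n : ℕ => ∫ ω,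
      Complex.exp (((t * ((√n)⁻¹ * ∑ k ∈ Finset.range n, D k ω) : ℝ) : ℂ) * Complex.I) ∂μ) atTop
      (𝓝 (∫ ω, (gaussWeight t (Γ ω) : ℂ) ∂μ)) := by
  have hD' (k : ℕ) : Measurable (D k) := (hD k).mono (ℱ.le _) le_rfl
  have hsq (k : ℕ) (ω : Ω) : D k ω ^ 2 ≤ 1 + |D k ω| ^ p := by
    rcases le_or_gt |D k ω| 1 with h | h
    · have h1 : D k ω ^ 2 ≤ 1 := by rw [← sq_abs]; exact pow_le_one₀ (abs_nonneg _) h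
      have : 0 ≤ |D k ω| ^ p := by positivity
      linarith
    · have h1 := Real.rpow_le_rpow_of_exponent_le h.le hp2.le
      rw [Real.rpow_two, sq_abs] at h1
      linarith
  have hD2 (k : ℕ) : Integrable (fun ω => D k ω ^ 2) μ := by
    refine Integrable.mono' ((integrable_const 1).add (hDp k))
      ((hD' k).pow_const 2).aestronglyMeasurable (ae_of_all _ fun ω => ?_)
    rw [Real.norm_eq_abs, abs_of_nonneg (sq_nonneg _)]
    exact hsq k ω
  have hK2 (k : ℕ) : ∫ ω, D k ω ^ 2 ∂μ ≤ 1 + K := by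
    refine (integral_mono (hD2 k) ((integrable_const 1).add (hDp k)) (hsq k)).trans ?_
    rw [integral_add' (integrable_const 1) (hDp k)]
    simpa using hK k
  set U : ℕ → Ω → ℝ := fun n ω => (n : ℝ)⁻¹ * ∑ k ∈ Finset.range n, D k ω ^ 2
  have hU (n : ℕ) : Measurable (U n) :=
    (Finset.measurable_fun_sum _ fun j hj => (hD' j).pow_const 2).const_mul _
  have hΓm : AEMeasurable Γ μ := hΓ.aemeasurable fun n => (hU n).aemeasurable
  set T : ℝ → ℕ → Ω → ℂ := fun C n ω => stoppedProd C t (fun j => (√n)⁻¹ * D j ω) n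
  have hTL {C : ℝ} (hC : 0 ≤ C) (n : ℕ) : MemLp (T C n) 2 μ := memLp_stoppedProd hD' hD2 hC t _ n
  set e : ℕ → Ω → ℂ := fun n ω =>
    Complex.exp (((t * ((√n)⁻¹ * ∑ k ∈ Finset.range n, D k ω) : ℝ) : ℂ) * Complex.I)
  have hem (n : ℕ) : Measurable (e n) := by
    have h1 : Measurable fun ω => t * ((√n)⁻¹ * ∑ k ∈ Finset.range n, D k ω) :=
      ((Finset.measurable_fun_sum _ fun j _ => hD' j).const_mul _).const_mul _
    fun_prop
  have hen (n : ℕ) (ω : Ω) : ‖e n ω‖ = 1 := Complex.norm_exp_ofReal_mul_I _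
  have hcomp {Φ : ℝ → ℝ} (hΦ : Continuous Φ) : AEMeasurable (fun ω => (Φ (Γ ω) : ℂ)) μ :=
    Complex.measurable_ofReal.comp_aemeasurable (hΦ.measurable.comp_aemeasurable hΓm)
  have hzm := hcomp (continuous_gaussWeight t)
  have hcm (C : ℝ) := hcomp (continuous_cutoff C)
  have hzn (ω : Ω) : ‖(gaussWeight t (Γ ω) : ℂ)‖ ≤ 1 := by simpa using abs_gaussWeight_le t (Γ ω)
  have hcn (C : ℝ) (ω : Ω) : ‖(cutoff C (Γ ω) : ℂ)‖ ≤ 1 := by simpa using abs_cutoff_le C (Γ ω)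
  have hmain {C : ℝ} (hC : 0 ≤ C) := tendsto_integral_exp_sub_stoppedProd_mul hD' hD2 hK2 hp2 hp3
    hDp hK hΓ hC t
  have hweight {C : ℝ} (hC : 0 ≤ C) := tendsto_integral_stoppedProd_sub_one_mul hD hD2 hmart hK2 hΓ
    hC t (Φ := fun v => gaussWeight t v * cutoff C v)
    ((continuous_gaussWeight t).mul (continuous_cutoff C)) (M := 1) (fun v => by
      rw [abs_mul]
      exact mul_le_one₀ (abs_gaussWeight_le t v) (abs_nonneg _) (abs_cutoff_le C v))
  -- removing the cutoff
  have hcut : Tendsto (fun N : ℕ => 2 * ∫ ω, |1 - cutoff N (Γ ω)| ∂μ) atTop (𝓝 0) := by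
    have h0 : 2 * ∫ _ : Ω, (0 : ℝ) ∂μ = 0 := by simp
    rw [← h0]
    refine (tendsto_integral_of_dominated_convergence (fun _ => 1) (fun N => ?_)
      (integrable_const _) (fun N => ae_of_all _ fun ω => ?_)
      (ae_of_all _ fun ω => ?_)).const_mul 2
    · exact (((continuous_cutoff N).measurable.comp_aemeasurable hΓm).const_sub 1
        ).norm.aestronglyMeasurable
    · rw [Real.norm_eq_abs, abs_abs, abs_of_nonneg (by linarith [cutoff_le_one N (Γ ω)])]
      linarith [cutoff_nonneg N (Γ ω)]
    · simpa using ((tendsto_cutoff_natCast (Γ ω)).const_sub 1).abs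
  rw [Metric.tendsto_nhds]
  intro ε hε
  obtain ⟨N, hN⟩ := (hcut.eventually (gt_mem_nhds (by positivity : 0 < ε / 3))).exists
  have hN0 : (0 : ℝ) ≤ N := Nat.cast_nonneg N
  filter_upwards [Metric.tendsto_nhds.1 (hmain hN0) (ε / 3) (by positivity),
    Metric.tendsto_nhds.1 (hweight hN0) (ε / 3) (by positivity)] with n h1 h2
  rw [dist_zero_right] at h1 h2
  rw [dist_eq_norm]
  have hie : Integrable (e n) μ :=
    Integrable.of_bound (hem n).aestronglyMeasurable 1 (ae_of_all _ fun ω => (hen n ω).le)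
  have hiz : Integrable (fun ω => (gaussWeight t (Γ ω) : ℂ)) μ :=
    Integrable.of_bound hzm.aestronglyMeasurable 1 (ae_of_all _ hzn)
  have hiT : Integrable (T N n) μ := (hTL hN0 n).integrable one_le_two
  have hj1 : Integrable (fun ω => (e n ω - T N n ω * (gaussWeight t (Γ ω) : ℂ))
      * (cutoff N (Γ ω) : ℂ)) μ :=
    (hie.sub (hiT.mul_bdd hzm.aestronglyMeasurable (ae_of_all _ hzn))).mul_bdd
      (hcm N).aestronglyMeasurable (ae_of_all _ (hcn N))
  have hj2 : Integrable (fun ω => (T N n ω - 1)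
      * ((gaussWeight t (Γ ω) * cutoff N (Γ ω) : ℝ) : ℂ)) μ := by
    have := ((hiT.sub (integrable_const 1)).mul_bdd hzm.aestronglyMeasurable
      (ae_of_all _ hzn)).mul_bdd (hcm N).aestronglyMeasurable (ae_of_all _ (hcn N))
    simpa [mul_assoc] using this
  have hj3 : Integrable (fun ω => (e n ω - (gaussWeight t (Γ ω) : ℂ))
      * ((1 : ℂ) - (cutoff N (Γ ω) : ℂ))) μ :=
    (hie.sub hiz).mul_bdd (c := 1 + 1) ((hcm N).const_sub 1).aestronglyMeasurable
      (ae_of_all _ fun ω => (norm_sub_le _ _).trans (add_le_add (by simp) (hcn N ω)))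
  -- With `w` the Gaussian weight and `χ` the cutoff, `e - w = (e - T w) χ + (T - 1) w χ + (e - w)(1
  -- - χ)`. The first two integrals vanish as `n` grows for fixed `N`; the third is small uniformly
  -- in `n` by the choice of `N`.
  have hsplit : ∫ ω, e n ω ∂μ - ∫ ω, (gaussWeight t (Γ ω) : ℂ) ∂μ
      = ∫ ω, (e n ω - T N n ω * (gaussWeight t (Γ ω) : ℂ)) * (cutoff N (Γ ω) : ℂ) ∂μ
        + ∫ ω, (T N n ω - 1) * ((gaussWeight t (Γ ω) * cutoff N (Γ ω) : ℝ) : ℂ) ∂μ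
        + ∫ ω, (e n ω - (gaussWeight t (Γ ω) : ℂ)) * ((1 : ℂ) - (cutoff N (Γ ω) : ℂ)) ∂μ := by
    have hj12 := hj1.add hj2
    simp only [Pi.add_def] at hj12
    rw [← integral_sub hie hiz, ← integral_add hj1 hj2, ← integral_add hj12 hj3]
    congr 1
    ext ω
    push_cast
    ring
  have h3 : ‖∫ ω, (e n ω - (gaussWeight t (Γ ω) : ℂ)) * ((1 : ℂ) - (cutoff N (Γ ω) : ℂ)) ∂μ‖
      < ε / 3 := by
    refine lt_of_le_of_lt ?_ hN
    rw [← integral_const_mul]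
    refine norm_integral_le_of_norm_le (Integrable.const_mul ?_ _) (ae_of_all _ fun ω => ?_)
    · refine Integrable.of_bound (((continuous_cutoff N).measurable.comp_aemeasurable
        hΓm).const_sub 1).norm.aestronglyMeasurable 1 (ae_of_all _ fun ω => ?_)
      rw [Real.norm_eq_abs, abs_abs, abs_of_nonneg (by linarith [cutoff_le_one N (Γ ω)])]
      linarith [cutoff_nonneg N (Γ ω)]
    · rw [norm_mul]
      gcongr
      · exact (norm_sub_le _ _).trans (by linarith [hen n ω, hzn ω])
      · rw [← Complex.ofReal_one, ← Complex.ofReal_sub, Complex.norm_real, Real.norm_eq_abs]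
  rw [hsplit]
  exact (norm_add_le _ _).trans_lt (lt_of_lt_of_eq
    (add_lt_add ((norm_add_le _ _).trans_lt (add_lt_add h1 h2)) h3) (by ring))

end MartingaleCLT

/-! ### The resolvent and the Poisson equation for a geometrically ergodic kernel. -/

section ErgodicKernel

variable {S : Type*} [MeasurableSpace S]

/-- `κ` is geometrically ergodic in the `W`-norm, with invariant distribution `π`, rate `ρ` and
constant `C`, and all its iterates integrate `W`. -/
structure IsErgodicKernel (κ : Kernel S S) (π : Measure S) (W : S → ℝ) (ρ C : ℝ) : Prop where
  invariant : Kernel.Invariant κ π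
  measurable : Measurable W
  one_le : ∀ x, 1 ≤ W x
  integrable : Integrable W π
  integrable_pow : ∀ (n : ℕ) (x : S), Integrable W ((κ ^ n) x)
  rate_nonneg : 0 ≤ ρ
  rate_lt_one : ρ < 1
  const_nonneg : 0 ≤ C
  bound : ∀ (n : ℕ) (x : S) (g : S → ℝ), Measurable g → ∀ c : ℝ, 0 ≤ c → (∀ y, |g y| ≤ c * W y) →
    |(∫ y, g y ∂((κ ^ n) x)) - ∫ y, g y ∂π| ≤ c * (C * ρ ^ n * W x)

instance isMarkovKernel_pow (κ : Kernel S S) [IsMarkovKernel κ] (n : ℕ) :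
    IsMarkovKernel (κ ^ n) := by
  induction n with
  | zero => exact inferInstanceAs (IsMarkovKernel Kernel.id)
  | succ n ih =>
    rw [pow_succ]
    exact inferInstanceAs (IsMarkovKernel ((κ ^ n) ∘ₖ κ))

lemma kernel_pow_succ (κ : Kernel S S) (n : ℕ) : κ ^ (n + 1) = (κ ^ n) ∘ₖ κ := pow_succ κ n

lemma kernel_pow_succ' (κ : Kernel S S) (n : ℕ) : κ ^ (n + 1) = κ ∘ₖ (κ ^ n) := pow_succ' κ n

lemma integral_pow_zero (κ : Kernel S S) {f : S → ℝ} (hf : Measurable f) (x : S) :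
    ∫ y, f y ∂((κ ^ 0) x) = f x := by
  have : (κ ^ 0) x = Measure.dirac x := Kernel.id_apply x
  rw [this, integral_dirac' _ _ hf.stronglyMeasurable]

lemma invariant_pow {κ : Kernel S S} {π : Measure S} (h : Kernel.Invariant κ π) (n : ℕ) :
    Kernel.Invariant (κ ^ n) π := by
  induction n with
  | zero => exact Measure.bind_dirac
  | succ n ih =>
    rw [kernel_pow_succ]
    exact ih.comp h

lemma integral_integral_of_invariant {κ : Kernel S S} {π : Measure S} (h : Kernel.Invariant κ π)
    {f : S → ℝ} (hf : Integrable f π) : ∫ x, ∫ y, f y ∂(κ x) ∂π = ∫ y, f y ∂π := by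
  -- The measure is treated as a constant kernel, which has to be evaluated at a point.
  rcases isEmpty_or_nonempty S with hS | ⟨⟨a⟩⟩
  · simp [Measure.eq_zero_of_isEmpty]
  have h1 : Integrable f ((κ ∘ₖ Kernel.const S π) a) := by
    rw [h.comp_const]; simpa using hf
  have h2 := Kernel.integral_comp h1
  rw [h.comp_const] at h2
  simpa using h2.symm

namespace IsErgodicKernel

variable {κ : Kernel S S} {π : Measure S} {W : S → ℝ}
  {ρ C : ℝ} {f : S → ℝ} {c : ℝ}

lemma integrable_of_le {ν : Measure S} (hW : Integrable W ν) (hf : Measurable f)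
    (hc : ∀ y, |f y| ≤ c * W y) : Integrable f ν :=
  (hW.const_mul c).mono' hf.aestronglyMeasurable (ae_of_all _ hc)

lemma measurable_integral_pow (κ : Kernel S S) (hf : Measurable f) (n : ℕ) :
    Measurable fun x => ∫ y, f y ∂((κ ^ n) x) :=
  (hf.stronglyMeasurable.integral_kernel (κ := κ ^ n)).measurable

lemma integral_integral_pow (H : IsErgodicKernel κ π W ρ C) (hf : Measurable f)
    (hc : ∀ y, |f y| ≤ c * W y) (n : ℕ) (x : S) :
    ∫ z, ∫ y, f y ∂((κ ^ n) z) ∂(κ x) = ∫ y, f y ∂((κ ^ (n + 1)) x) := by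
  have h := integrable_of_le (H.integrable_pow (n + 1) x) hf hc
  rw [kernel_pow_succ] at h ⊢
  exact (Kernel.integral_comp h).symm

lemma integral_pow_integral (H : IsErgodicKernel κ π W ρ C) (hf : Measurable f)
    (hc : ∀ y, |f y| ≤ c * W y) (n : ℕ) (x : S) :
    ∫ z, ∫ y, f y ∂(κ z) ∂((κ ^ n) x) = ∫ y, f y ∂((κ ^ (n + 1)) x) := by
  have h := integrable_of_le (H.integrable_pow (n + 1) x) hf hc
  rw [kernel_pow_succ'] at h ⊢
  exact (Kernel.integral_comp h).symm

lemma integral_integral_pow_invariant (H : IsErgodicKernel κ π W ρ C) (hf : Measurable f)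
    (hc : ∀ y, |f y| ≤ c * W y) (n : ℕ) :
    ∫ z, ∫ y, f y ∂((κ ^ n) z) ∂π = ∫ y, f y ∂π :=
  integral_integral_of_invariant (invariant_pow H.invariant n) (integrable_of_le H.integrable hf hc)

lemma abs_integral_pow_le (H : IsErgodicKernel κ π W ρ C) (hf : Measurable f) (hc0 : 0 ≤ c)
    (hc : ∀ y, |f y| ≤ c * W y) (hπ : ∫ y, f y ∂π = 0) (n : ℕ) (x : S) :
    |∫ y, f y ∂((κ ^ n) x)| ≤ c * C * W x * ρ ^ n := by
  have h := H.bound n x f hf c hc0 hc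
  rw [hπ, sub_zero] at h
  linarith

/-- By invariance every iterate of a centered function stays centered, so the term subtracted by
`centered` is always zero. -/
lemma iterate_centered (H : IsErgodicKernel κ π W ρ C) (hf : Measurable f)
    (hc : ∀ y, |f y| ≤ c * W y) (hπ : ∫ y, f y ∂π = 0) (n : ℕ) (x : S) :
    ((centered κ π)^[n] f) x = ∫ y, f y ∂((κ ^ n) x) := by
  induction n generalizing x with
  | zero => rw [integral_pow_zero κ hf]; rfl
  | succ n ih =>
    rw [Function.iterate_succ_apply', centered]
    simp only [ih]
    rw [H.integral_integral_pow hf hc, H.integral_integral_pow_invariant hf hc, hπ, sub_zero]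

lemma resolvent_eq (H : IsErgodicKernel κ π W ρ C) (hf : Measurable f)
    (hc : ∀ y, |f y| ≤ c * W y) (hπ : ∫ y, f y ∂π = 0) :
    resolvent κ π f = fun x => ∑' n : ℕ, ∫ y, f y ∂((κ ^ n) x) := by
  ext x
  simp only [resolvent, H.iterate_centered hf hc hπ]

lemma summable_integral_pow (H : IsErgodicKernel κ π W ρ C) (hf : Measurable f) (hc0 : 0 ≤ c)
    (hc : ∀ y, |f y| ≤ c * W y) (hπ : ∫ y, f y ∂π = 0) (x : S) :
    Summable fun n : ℕ => ∫ y, f y ∂((κ ^ n) x) :=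
  Summable.of_norm_bounded
    ((summable_geometric_of_lt_one H.rate_nonneg H.rate_lt_one).mul_left _)
    fun n => H.abs_integral_pow_le hf hc0 hc hπ n x

lemma abs_resolvent_le (H : IsErgodicKernel κ π W ρ C) (hf : Measurable f) (hc0 : 0 ≤ c)
    (hc : ∀ y, |f y| ≤ c * W y) (hπ : ∫ y, f y ∂π = 0) (x : S) :
    |resolvent κ π f x| ≤ c * (C * (1 - ρ)⁻¹) * W x := by
  rw [H.resolvent_eq hf hc hπ]
  have h := tsum_of_norm_bounded
    ((hasSum_geometric_of_lt_one H.rate_nonneg H.rate_lt_one).mul_left (c * C * W x))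
    fun n => (Real.norm_eq_abs _).trans_le (H.abs_integral_pow_le hf hc0 hc hπ n x)
  rw [Real.norm_eq_abs] at h
  linarith

lemma measurable_resolvent (H : IsErgodicKernel κ π W ρ C) (hf : Measurable f) (hc0 : 0 ≤ c)
    (hc : ∀ y, |f y| ≤ c * W y) (hπ : ∫ y, f y ∂π = 0) : Measurable (resolvent κ π f) := by
  rw [H.resolvent_eq hf hc hπ]
  refine measurable_of_tendsto_metrizable (f := fun N x => ∑ n ∈ Finset.range N,
    ∫ y, f y ∂((κ ^ n) x)) (fun N => ?_) (tendsto_pi_nhds.2 fun x => ?_)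
  · exact Finset.measurable_fun_sum _ fun n _ => measurable_integral_pow κ hf n
  · exact (H.summable_integral_pow hf hc0 hc hπ x).hasSum.tendsto_sum_nat

lemma hasSum_integral_resolvent (H : IsErgodicKernel κ π W ρ C) (hf : Measurable f) (hc0 : 0 ≤ c)
    (hc : ∀ y, |f y| ≤ c * W y) (hπ : ∫ y, f y ∂π = 0) {ν : Measure S} (hν : Integrable W ν) :
    HasSum (fun n : ℕ => ∫ z, ∫ y, f y ∂((κ ^ n) z) ∂ν) (∫ z, resolvent κ π f z ∂ν) := by
  rw [H.resolvent_eq hf hc hπ]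
  have hb (n : ℕ) (x : S) : |∫ y, f y ∂((κ ^ n) x)| ≤ c * C * ρ ^ n * W x := by
    linarith [H.abs_integral_pow_le hf hc0 hc hπ n x]
  have hi (n : ℕ) : Integrable (fun x => ∫ y, f y ∂((κ ^ n) x)) ν :=
    integrable_of_le hν (measurable_integral_pow κ hf n) (hb n)
  refine hasSum_integral_of_summable_integral_norm hi ?_
  refine Summable.of_nonneg_of_le (fun n => integral_nonneg fun x => norm_nonneg _) (fun n => ?_)
    ((summable_geometric_of_lt_one H.rate_nonneg H.rate_lt_one).mul_left (c * C * ∫ x, W x ∂ν))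
  calc _ ≤ ∫ x, c * C * ρ ^ n * W x ∂ν := integral_mono (hi n).norm (hν.const_mul _) (hb n)
    _ = _ := by rw [integral_const_mul]; ring

/-- The Poisson equation `g - κ g = f` for the resolvent `g` of `f`. -/
lemma integral_resolvent (H : IsErgodicKernel κ π W ρ C) (hf : Measurable f) (hc0 : 0 ≤ c)
    (hc : ∀ y, |f y| ≤ c * W y) (hπ : ∫ y, f y ∂π = 0) (x : S) :
    ∫ z, resolvent κ π f z ∂(κ x) = resolvent κ π f x - f x := by
  have hν : Integrable W (κ x) := by simpa using H.integrable_pow 1 x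
  have h1 := H.hasSum_integral_resolvent hf hc0 hc hπ hν
  simp only [H.integral_integral_pow hf hc] at h1
  have h2 := (H.summable_integral_pow hf hc0 hc hπ x).hasSum
  rw [← hasSum_nat_add_iff' 1] at h2
  simp only [Finset.sum_range_one, integral_pow_zero κ hf] at h2
  rw [H.resolvent_eq hf hc hπ] at h1 ⊢
  exact h1.unique h2

lemma integral_resolvent_eq_zero (H : IsErgodicKernel κ π W ρ C) (hf : Measurable f) (hc0 : 0 ≤ c)
    (hc : ∀ y, |f y| ≤ c * W y) (hπ : ∫ y, f y ∂π = 0) : ∫ z, resolvent κ π f z ∂π = 0 := by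
  have h1 := H.hasSum_integral_resolvent hf hc0 hc hπ H.integrable
  simp only [H.integral_integral_pow_invariant hf hc, hπ] at h1
  exact h1.unique hasSum_zero

/-- A centered function is controlled by its image under `1 - κ`. -/
lemma abs_le_of_abs_sub_integral_le (H : IsErgodicKernel κ π W ρ C) {u : S → ℝ} (hu : Measurable u)
    {a : ℝ} (ha0 : 0 ≤ a) (ha : ∀ y, |u y| ≤ a * W y) (hπ : ∫ y, u y ∂π = 0) {d : ℝ} (hd0 : 0 ≤ d)
    (hd : ∀ y, |u y - ∫ z, u z ∂(κ y)| ≤ d * W y) (x : S) :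
    |u x| ≤ d * (C * (1 - ρ)⁻¹) * W x := by
  have hκu : Measurable fun y => ∫ z, u z ∂(κ y) := by
    simpa using measurable_integral_pow κ hu 1
  have hWx : 0 ≤ W x := zero_le_one.trans (H.one_le x)
  have hκint {ν : Measure S} (hν : Integrable W ν) : Integrable (fun y => ∫ z, u z ∂(κ y)) ν := by
    refine integrable_of_le (c := a * C * ρ) hν hκu fun y => ?_
    have := H.abs_integral_pow_le hu ha0 ha hπ 1 y
    rw [pow_one, pow_one] at this
    linarith
  have hw : Measurable fun y => u y - ∫ z, u z ∂(κ y) := hu.sub hκu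
  have hwπ : ∫ y, (u y - ∫ z, u z ∂(κ y)) ∂π = 0 := by
    rw [integral_sub (integrable_of_le H.integrable hu ha) (hκint H.integrable),
      integral_integral_of_invariant H.invariant (integrable_of_le H.integrable hu ha), sub_self]
  have hstep (n : ℕ) : ∫ y, (u y - ∫ z, u z ∂(κ y)) ∂((κ ^ n) x)
      = ∫ y, u y ∂((κ ^ n) x) - ∫ y, u y ∂((κ ^ (n + 1)) x) := by
    rw [integral_sub (integrable_of_le (H.integrable_pow n x) hu ha) (hκint (H.integrable_pow n x)),
      H.integral_pow_integral hu ha]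
  -- With `w = u - κ u`, the sum of `κ ^ n w` over `n < N` telescopes. Each term decays
  -- geometrically since `w` is centered, and `κ ^ N u` tends to zero.
  have htel (N : ℕ) : u x - ∫ y, u y ∂((κ ^ N) x)
      = ∑ n ∈ Finset.range N, ∫ y, (u y - ∫ z, u z ∂(κ y)) ∂((κ ^ n) x) := by
    simp only [hstep]
    rw [Finset.sum_range_sub', integral_pow_zero κ hu]
  have hsum (N : ℕ) : |u x - ∫ y, u y ∂((κ ^ N) x)| ≤ d * (C * (1 - ρ)⁻¹) * W x := by
    rw [htel]
    calc _ ≤ ∑ n ∈ Finset.range N, d * C * W x * ρ ^ n :=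
          (Finset.abs_sum_le_sum_abs _ _).trans (Finset.sum_le_sum fun n _ =>
            H.abs_integral_pow_le hw hd0 hd hwπ n x)
      _ = d * C * W x * ∑ n ∈ Finset.range N, ρ ^ n := by rw [Finset.mul_sum]
      _ ≤ d * C * W x * (1 - ρ)⁻¹ := by
          have := H.const_nonneg
          gcongr
          rw [← tsum_geometric_of_lt_one H.rate_nonneg H.rate_lt_one]
          exact (summable_geometric_of_lt_one H.rate_nonneg H.rate_lt_one).sum_le_tsum _
            fun n _ => pow_nonneg H.rate_nonneg n
      _ = _ := by ring
  have hlim : Tendsto (fun N : ℕ => ∫ y, u y ∂((κ ^ N) x)) atTop (𝓝 0) :=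
    (H.summable_integral_pow hu ha0 ha hπ x).tendsto_atTop_zero
  have h := (hlim.const_sub (u x)).abs
  rw [sub_zero] at h
  exact le_of_tendsto' h hsum

end IsErgodicKernel

end ErgodicKernel

/-! ### From the extended-real norms and distances to pointwise inequalities. -/

section Norms

variable {S : Type*} [MeasurableSpace S] {W : S → ℝ}

lemma wNorm_le_one {S : Type*} {W f : S → ℝ} (hW : ∀ x, 1 ≤ W x) (hf : ∀ x, |f x| ≤ W x) :
    wNorm W f ≤ 1 :=
  iSup_le fun x => by
    rw [← ENNReal.ofReal_one]
    exact ENNReal.ofReal_le_ofReal ((div_le_one (by linarith [hW x])).2 (hf x))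

lemma MemLW.exists_abs_le {f : S → ℝ} (hf : MemLW W f) (hW : ∀ x, 1 ≤ W x) :
    ∃ c : ℝ, 0 ≤ c ∧ ∀ x, |f x| ≤ c * W x := by
  refine ⟨(wNorm W f).toReal, ENNReal.toReal_nonneg, fun x => ?_⟩
  have hx : 0 < W x := by linarith [hW x]
  rw [← div_le_iff₀ hx]
  refine (ENNReal.ofReal_le_iff_le_toReal hf.2.ne).1 ?_
  exact le_iSup (fun x => ENNReal.ofReal (|f x| / W x)) x

lemma abs_integral_sub_le_of_wDist_le {μ ν : Measure S} (hW : ∀ x, 1 ≤ W x) {r : ℝ} (hr : 0 ≤ r)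
    (h : wDist W μ ν ≤ ENNReal.ofReal r) {g : S → ℝ} (hg : Measurable g) {c : ℝ} (hc0 : 0 ≤ c)
    (hc : ∀ y, |g y| ≤ c * W y) : |(∫ y, g y ∂μ) - ∫ y, g y ∂ν| ≤ c * r := by
  rcases hc0.eq_or_lt with rfl | hc1
  · have : g = fun _ => 0 := by
      ext y
      simpa using hc y
    simp [this]
  · have hn : wNorm W (fun y => c⁻¹ * g y) ≤ 1 := by
      refine wNorm_le_one hW fun x => ?_
      rw [abs_mul, abs_of_pos (inv_pos.2 hc1), inv_mul_le_iff₀ hc1]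
      exact hc x
    have h1 : ENNReal.ofReal |(∫ y, c⁻¹ * g y ∂μ) - ∫ y, c⁻¹ * g y ∂ν| ≤ ENNReal.ofReal r := by
      refine le_trans ?_ h
      refine le_iSup₂_of_le (fun y => c⁻¹ * g y) (hg.const_mul _) ?_
      exact le_iSup_of_le hn le_rfl
    rw [ENNReal.ofReal_le_ofReal_iff hr, integral_const_mul, integral_const_mul, ← mul_sub,
      abs_mul, abs_of_pos (inv_pos.2 hc1), inv_mul_le_iff₀ hc1] at h1
    exact h1

/-- The distance must be finite because `toReal` sends infinity to zero. -/
lemma abs_integral_sub_le_kernelDist {Θ : Type*} {P : Θ → Kernel S S} {V : S → ℝ} {β : ℝ}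
    (hV : ∀ x, 1 ≤ V x ^ β) {θ θ' : Θ} (hD : kernelDist P V β θ θ' ≠ ∞) {g : S → ℝ}
    (hg : Measurable g) {c : ℝ} (hc0 : 0 ≤ c) (hc : ∀ y, |g y| ≤ c * V y ^ β) (x : S) :
    |(∫ y, g y ∂(P θ x)) - ∫ y, g y ∂(P θ' x)|
      ≤ c * ((kernelDist P V β θ θ').toReal * V x ^ β) := by
  have hx : 0 < V x ^ β := by linarith [hV x]
  refine abs_integral_sub_le_of_wDist_le hV (by positivity) ?_ hg hc0 hc
  refine iSup_le fun f => iSup₂_le fun hf hn => ?_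
  refine ENNReal.ofReal_le_ofReal ?_
  rw [← div_le_iff₀ hx]
  refine (ENNReal.ofReal_le_iff_le_toReal hD).1 ?_
  exact le_iSup₂_of_le f hf (le_iSup₂_of_le hn x le_rfl)

end Norms

/-! ### Drift, integrability of `V`, and dependence of the resolvent on the kernel. -/

/-- The map `s ↦ lam * s + b` has fixed point `b / (1 - lam)`, so it does not increase `a + b / (1 -
lam)`. This serves both the iterates of a single kernel and the adaptive chain. -/
lemma le_ofReal_of_drift {u : ℕ → ℝ≥0∞} {a b lam : ℝ} (ha : 0 ≤ a) (hb : 0 < b) (hl0 : 0 < lam)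
    (hl1 : lam < 1) (h0 : u 0 ≤ ENNReal.ofReal a)
    (h : ∀ n, u (n + 1) ≤ ENNReal.ofReal lam * u n + ENNReal.ofReal b) (n : ℕ) :
    u n ≤ ENNReal.ofReal (a + b / (1 - lam)) := by
  have h1 : 0 < 1 - lam := by linarith
  induction n with
  | zero => exact h0.trans (ENNReal.ofReal_le_ofReal (by have : 0 < b / (1 - lam) := by positivity
                                                         linarith))
  | succ n ih =>
    refine (h n).trans ?_
    calc _ ≤ ENNReal.ofReal lam * ENNReal.ofReal (a + b / (1 - lam)) + ENNReal.ofReal b := by gcongr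
      _ = ENNReal.ofReal (lam * (a + b / (1 - lam)) + b) := by
        rw [← ENNReal.ofReal_mul hl0.le, ← ENNReal.ofReal_add (by positivity) hb.le]
      _ ≤ _ := by
        refine ENNReal.ofReal_le_ofReal ?_
        have : b = (1 - lam) * (b / (1 - lam)) := by field_simp
        nlinarith

lemma lintegral_le_of_drift {S : Type*} [MeasurableSpace S] {ν : Measure S} [IsProbabilityMeasure ν]
    {V : S → ℝ} (hV : Measurable V) (hV1 : ∀ x, 1 ≤ V x) {b lam : ℝ} (hb : 0 < b) (hl0 : 0 < lam)
    {F : S → ℝ≥0∞} (hF : ∀ x, F x ≤ ENNReal.ofReal (lam * V x + b)) :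
    ∫⁻ x, F x ∂ν ≤ ENNReal.ofReal lam * ∫⁻ x, ENNReal.ofReal (V x) ∂ν + ENNReal.ofReal b := by
  calc _ ≤ ∫⁻ x, (ENNReal.ofReal lam * ENNReal.ofReal (V x) + ENNReal.ofReal b) ∂ν := by
        refine lintegral_mono fun x => (hF x).trans_eq ?_
        have := hV1 x
        rw [ENNReal.ofReal_add (by positivity) hb.le, ENNReal.ofReal_mul hl0.le]
    _ = _ := by
        rw [lintegral_add_right _ measurable_const, lintegral_const_mul _ hV.ennreal_ofReal]
        simp

lemma one_le_rpow_of_one_le {v β : ℝ} (hv : 1 ≤ v) (hβ : 0 ≤ β) : 1 ≤ v ^ β :=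
  Real.one_le_rpow hv hβ

lemma rpow_le_self_of_one_le' {v β : ℝ} (hv : 1 ≤ v) (hβ : β ≤ 1) : v ^ β ≤ v := by
  simpa using Real.rpow_le_rpow_of_exponent_le hv hβ

namespace AssumptionA1

variable {𝓧 Θ : Type*} [MeasurableSpace 𝓧] [MeasurableSpace Θ] {P : Θ → Kernel 𝓧 𝓧}
  {π : Measure 𝓧} {μ₀ : Measure (𝓧 × Θ)}
  {V : 𝓧 → ℝ} {β : ℝ}

lemma integrable_V_of_lintegral_lt_top {S : Type*} [MeasurableSpace S] {ν : Measure S} {V : S → ℝ}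
    (hV : Measurable V) (hV1 : ∀ x, 1 ≤ V x) (h : ∫⁻ x, ENNReal.ofReal (V x) ∂ν < ∞) :
    Integrable V ν :=
  ⟨hV.aestronglyMeasurable, (hasFiniteIntegral_iff_ofReal
    (ae_of_all _ fun x => zero_le_one.trans (hV1 x))).2 h⟩

lemma integrable_V_pow [∀ θ, IsMarkovKernel (P θ)] (hA1 : AssumptionA1 P π μ₀ V) (θ : Θ)
    (n : ℕ) (x : 𝓧) :
    Integrable V ((P θ ^ n) x) := by
  obtain ⟨b, lam, hb, hl0, hl1, hdr⟩ := hA1.drift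
  have hVm : Measurable fun y => ENNReal.ofReal (V y) := hA1.measurable_V.ennreal_ofReal
  refine integrable_V_of_lintegral_lt_top hA1.measurable_V hA1.one_le_V ?_
  refine (le_ofReal_of_drift (u := fun n => ∫⁻ y, ENNReal.ofReal (V y) ∂((P θ ^ n) x))
    (zero_le_one.trans (hA1.one_le_V x)) hb hl0 hl1 ?_ (fun n => ?_) n).trans_lt
    ENNReal.ofReal_lt_top
  · have : (P θ ^ 0) x = Measure.dirac x := Kernel.id_apply x
    rw [this, lintegral_dirac' _ hVm]
  · rw [kernel_pow_succ', Kernel.lintegral_comp _ _ _ hVm]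
    exact lintegral_le_of_drift hA1.measurable_V hA1.one_le_V hb hl0 fun y => hdr y θ

/-- The ergodicity bound says nothing directly about `V`, since a non-integrable function has
integral zero by convention. It is applied with exponent one and `n = 0` to the truncations of `V`,
whose integrals are then uniformly bounded, and monotone convergence concludes. -/
lemma integrable_V [IsProbabilityMeasure π] (hA1 : AssumptionA1 P π μ₀ V) [Nonempty Θ] :
    Integrable V π := by
  obtain ⟨ρ, C, -, -, hC, hG⟩ := hA1.ergodic 1 zero_lt_one le_rfl
  obtain ⟨x⟩ : Nonempty 𝓧 := nonempty_of_isProbabilityMeasure π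
  obtain ⟨θ⟩ := ‹Nonempty Θ›
  have hV1 := hA1.one_le_V
  have hVx : 0 ≤ V x := zero_le_one.trans (hV1 x)
  have hm (N : ℕ) : Measurable fun y => min (V y) N := hA1.measurable_V.min measurable_const
  have hnn (N : ℕ) (y : 𝓧) : 0 ≤ min (V y) N :=
    le_min (zero_le_one.trans (hV1 y)) (Nat.cast_nonneg N)
  have hbound (N : ℕ) : ∫ y, min (V y) N ∂π ≤ V x + C * V x := by
    have h := abs_integral_sub_le_of_wDist_le (W := fun y => V y ^ (1 : ℝ))
      (by simpa using hV1) (r := C * ρ ^ 0 * V x ^ (1 : ℝ)) (by simp; positivity) (hG x θ 0)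
      (hm N) zero_le_one (fun y => by
        rw [abs_of_nonneg (hnn N y)]
        simp)
    rw [integral_pow_zero _ (hm N)] at h
    have h1 := (abs_le.1 h).1
    simp only [pow_zero, Real.rpow_one] at h1
    linarith [min_le_left (V x) N]
  have hl (N : ℕ) : ∫⁻ y, ENNReal.ofReal (min (V y) N) ∂π ≤ ENNReal.ofReal (V x + C * V x) := by
    rw [← ofReal_integral_eq_lintegral_ofReal _ (ae_of_all _ (hnn N))]
    · exact ENNReal.ofReal_le_ofReal (hbound N)
    · refine Integrable.of_bound (hm N).aestronglyMeasurable N (ae_of_all _ fun y => ?_)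
      rw [Real.norm_eq_abs, abs_of_nonneg (hnn N y)]
      exact min_le_right _ _
  have hlim : Tendsto (fun N : ℕ => ∫⁻ y, ENNReal.ofReal (min (V y) N) ∂π) atTop
      (𝓝 (∫⁻ y, ENNReal.ofReal (V y) ∂π)) := by
    refine lintegral_tendsto_of_tendsto_of_monotone
      (fun N => (hm N).ennreal_ofReal.aemeasurable) (ae_of_all _ fun y N M hNM => ?_)
      (ae_of_all _ fun y => ?_)
    · exact ENNReal.ofReal_le_ofReal (min_le_min le_rfl (by exact_mod_cast hNM))
    · refine tendsto_const_nhds.congr' ?_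
      filter_upwards [tendsto_natCast_atTop_atTop.eventually_ge_atTop (V y)] with N hN
      rw [min_eq_left hN]
  exact integrable_V_of_lintegral_lt_top hA1.measurable_V hV1
    ((le_of_tendsto' hlim hl).trans_lt ENNReal.ofReal_lt_top)

lemma exists_isErgodicKernel [∀ θ, IsMarkovKernel (P θ)] [IsProbabilityMeasure π]
    (hA1 : AssumptionA1 P π μ₀ V) (hβ0 : 0 ≤ β) (hβ1 : β ≤ 1)
    (hG : GeomErgodic P π V β) :
    ∃ ρ C : ℝ, ∀ θ, IsErgodicKernel (P θ) π (fun y => V y ^ β) ρ C := by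
  obtain ⟨ρ, C, hρ0, hρ1, hC, h⟩ := hG
  refine ⟨ρ, C, fun θ => ?_⟩
  have : Nonempty Θ := ⟨θ⟩
  have hW : Measurable fun y => V y ^ β := hA1.measurable_V.pow_const β
  have hW1 (x : 𝓧) : 1 ≤ V x ^ β := one_le_rpow_of_one_le (hA1.one_le_V x) hβ0
  have hint {ν : Measure 𝓧} (hν : Integrable V ν) : Integrable (fun y => V y ^ β) ν := by
    refine hν.mono' hW.aestronglyMeasurable (ae_of_all _ fun y => ?_)
    rw [Real.norm_eq_abs, abs_of_nonneg (zero_le_one.trans (hW1 y))]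
    exact rpow_le_self_of_one_le' (hA1.one_le_V y) hβ1
  exact
    { invariant := hA1.invariant θ
      measurable := hW
      one_le := hW1
      integrable := hint hA1.integrable_V
      integrable_pow := fun n x => hint (hA1.integrable_V_pow θ n x)
      rate_nonneg := hρ0.le
      rate_lt_one := hρ1
      const_nonneg := hC.le
      bound := fun n x g hg c hc0 hc => by
        have := hW1 x
        exact abs_integral_sub_le_of_wDist_le hW1 (by positivity) (h x θ n) hg hc0 hc }

end AssumptionA1

/-- Lipschitz dependence of the resolvent on the kernel. -/
lemma abs_resolvent_sub_le {𝓧 Θ : Type*} [MeasurableSpace 𝓧] {P : Θ → Kernel 𝓧 𝓧} {π : Measure 𝓧}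
    {V : 𝓧 → ℝ} {β ρ C : ℝ} (H : ∀ θ, IsErgodicKernel (P θ) π (fun y => V y ^ β) ρ C) {h : 𝓧 → ℝ}
    (hh : Measurable h) {c : ℝ} (hc0 : 0 ≤ c) (hc : ∀ y, |h y| ≤ c * V y ^ β)
    (hπ : ∫ y, h y ∂π = 0) {θ θ' : Θ} (hD : kernelDist P V β θ θ' ≠ ∞) (x : 𝓧) :
    |resolvent (P θ) π h x - resolvent (P θ') π h x|
      ≤ c * (C * (1 - ρ)⁻¹) ^ 2 * ((kernelDist P V β θ θ').toReal * V x ^ β) := by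
  set g := fun θ => resolvent (P θ) π h
  have hK : 0 ≤ C * (1 - ρ)⁻¹ :=
    mul_nonneg (H θ).const_nonneg (inv_nonneg.2 (by linarith [(H θ).rate_lt_one]))
  have hg (θ : Θ) : Measurable (g θ) := (H θ).measurable_resolvent hh hc0 hc hπ
  have hgb (θ : Θ) (y : 𝓧) : |g θ y| ≤ c * (C * (1 - ρ)⁻¹) * V y ^ β :=
    (H θ).abs_resolvent_le hh hc0 hc hπ y
  have hgi (θ : Θ) {ν : Measure 𝓧} (hν : Integrable (fun y => V y ^ β) ν) : Integrable (g θ) ν :=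
    IsErgodicKernel.integrable_of_le hν (hg θ) (hgb θ)
  have hint (θ : Θ) (y : 𝓧) : Integrable (fun y => V y ^ β) (P θ y) := by
    simpa using (H θ).integrable_pow 1 y
  have hcK : 0 ≤ c * (C * (1 - ρ)⁻¹) := mul_nonneg hc0 hK
  -- For `u = g θ - g θ'` the two Poisson equations give `u - P θ u = (P θ - P θ') (g θ')`. One
  -- factor `C / (1 - ρ)` comes from the size of `g θ'`, the other from inverting `1 - P θ` on
  -- centered functions.
  have key := (H θ).abs_le_of_abs_sub_integral_le (u := fun y => g θ y - g θ' y)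
    ((hg θ).sub (hg θ')) (a := 2 * (c * (C * (1 - ρ)⁻¹))) (by positivity)
    (fun y => (abs_sub _ _).trans (by linarith [hgb θ y, hgb θ' y]))
    (by
      rw [integral_sub (hgi θ (H θ).integrable) (hgi θ' (H θ).integrable)]
      simp only [g]
      rw [(H θ).integral_resolvent_eq_zero hh hc0 hc hπ,
        (H θ').integral_resolvent_eq_zero hh hc0 hc hπ, sub_zero])
    (d := c * (C * (1 - ρ)⁻¹) * (kernelDist P V β θ θ').toReal) (by positivity)
    (fun y => by
      have h1 := (H θ).integral_resolvent hh hc0 hc hπ y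
      have h2 := (H θ').integral_resolvent hh hc0 hc hπ y
      have h3 := abs_integral_sub_le_kernelDist (H θ).one_le hD (hg θ') hcK (hgb θ') y
      rw [integral_sub (hgi θ (hint θ y)) (hgi θ' (hint θ y))]
      simp only [g] at h3 ⊢
      rw [h1]
      rw [h2] at h3
      calc _ = |(∫ z, resolvent (P θ') π h z ∂(P θ y)) - (resolvent (P θ') π h y - h y)| := by
            congr 1; ring
        _ ≤ _ := h3
        _ = _ := by ring) x
  calc _ ≤ _ := key
    _ = _ := by ring

/-! ### Joint measurability of the resolvent in parameter and state. -/

section JointMeasurability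

variable {𝓧 Θ : Type*} [MeasurableSpace 𝓧] [MeasurableSpace Θ] {P : Θ → Kernel 𝓧 𝓧}

/-- The family `(P θ)` as a single kernel on the product space. -/
noncomputable def jointKernel (P : Θ → Kernel 𝓧 𝓧)
    (hP : ∀ A : Set 𝓧, MeasurableSet A → Measurable (fun p : Θ × 𝓧 => P p.1 p.2 A)) :
    Kernel (Θ × 𝓧) 𝓧 where
  toFun p := P p.1 p.2
  measurable' := Measure.measurable_of_measurable_coe _ hP

lemma jointKernel_apply
    (hP : ∀ A : Set 𝓧, MeasurableSet A → Measurable (fun p : Θ × 𝓧 => P p.1 p.2 A)) (p : Θ × 𝓧) :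
    jointKernel P hP p = P p.1 p.2 := rfl

instance isMarkovKernel_jointKernel [∀ θ, IsMarkovKernel (P θ)]
    (hP : ∀ A : Set 𝓧, MeasurableSet A → Measurable (fun p : Θ × 𝓧 => P p.1 p.2 A)) :
    IsMarkovKernel (jointKernel P hP) :=
  ⟨fun p => by rw [jointKernel_apply]; infer_instance⟩

lemma measurable_iterate_centered [∀ θ, IsMarkovKernel (P θ)]
    (hP : ∀ A : Set 𝓧, MeasurableSet A → Measurable (fun p : Θ × 𝓧 => P p.1 p.2 A))
    (π : Measure 𝓧) [SFinite π] {h : 𝓧 → ℝ} (hh : Measurable h) (n : ℕ) :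
    Measurable fun p : Θ × 𝓧 => ((centered (P p.1) π)^[n] h) p.2 := by
  induction n with
  | zero => exact hh.comp measurable_snd
  | succ n ih =>
    simp only [Function.iterate_succ_apply', centered]
    -- The integrand depends on the same parameter as the kernel, so it is integrated as a function
    -- of the kernel's source point and target point together.
    have h1 : Measurable fun q : (Θ × 𝓧) × 𝓧 => ((centered (P q.1.1) π)^[n] h) q.2 :=
      ih.comp ((measurable_fst.comp measurable_fst).prodMk measurable_snd)
    refine Measurable.sub ?_ ?_
    · exact (h1.stronglyMeasurable.integral_kernel_prod_right' (κ := jointKernel P hP)).measurable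
    · exact (h1.stronglyMeasurable.integral_prod_right').measurable

lemma measurable_resolvent_uncurry [∀ θ, IsMarkovKernel (P θ)]
    (hP : ∀ A : Set 𝓧, MeasurableSet A → Measurable (fun p : Θ × 𝓧 => P p.1 p.2 A))
    {π : Measure 𝓧} [SFinite π] {W : 𝓧 → ℝ} {ρ C : ℝ} (H : ∀ θ, IsErgodicKernel (P θ) π W ρ C)
    {h : 𝓧 → ℝ} (hh : Measurable h) {c : ℝ} (hc0 : 0 ≤ c) (hc : ∀ y, |h y| ≤ c * W y)
    (hπ : ∫ y, h y ∂π = 0) : Measurable fun p : Θ × 𝓧 => resolvent (P p.1) π h p.2 := by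
  refine measurable_of_tendsto_metrizable (f := fun N (p : Θ × 𝓧) => ∑ n ∈ Finset.range N,
    ((centered (P p.1) π)^[n] h) p.2) (fun N => ?_) (tendsto_pi_nhds.2 fun p => ?_)
  · exact Finset.measurable_fun_sum _ fun n _ => measurable_iterate_centered hP π hh n
  · have hs := (H p.1).summable_integral_pow hh hc0 hc hπ p.2
    simp only [← (H p.1).iterate_centered hh hc hπ] at hs
    exact hs.hasSum.tendsto_sum_nat

end JointMeasurability

/-! ### Almost sure negligibility after division by √n. -/

/-- The `p`-th powers have expectations of order `n ^ (-p/2)`, summable since `p > 2`. Their series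
is therefore finite almost surely, and its terms tend to zero. -/
lemma ae_tendsto_inv_sqrt_mul {Ω : Type*} {mΩ : MeasurableSpace Ω} {μ : Measure Ω}
    {Y : ℕ → Ω → ℝ} (hY : ∀ n, Measurable (Y n)) (hY0 : ∀ n ω, 0 ≤ Y n ω) {p : ℝ} (hp : 2 < p)
    {K : ℝ≥0∞} (hK : K ≠ ∞) (hbound : ∀ n, ∫⁻ ω, ENNReal.ofReal (Y n ω ^ p) ∂μ ≤ K) :
    ∀ᵐ ω ∂μ, Tendsto (fun n : ℕ => (√n)⁻¹ * Y n ω) atTop (𝓝 0) := by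
  have hp0 : 0 < p := by linarith
  have heq (n : ℕ) (ω : Ω) : ((√n)⁻¹ * Y n ω) ^ p = (n : ℝ) ^ (-(p / 2)) * Y n ω ^ p := by
    rw [Real.mul_rpow (by positivity) (hY0 n ω)]
    congr 1
    rw [Real.inv_rpow (Real.sqrt_nonneg _), Real.sqrt_eq_rpow, ← Real.rpow_mul (Nat.cast_nonneg n),
      ← Real.rpow_neg (Nat.cast_nonneg n)]
    congr 1
    ring
  have hm (n : ℕ) : Measurable fun ω => ENNReal.ofReal (((√n)⁻¹ * Y n ω) ^ p) :=
    (((hY n).const_mul _).pow_const p).ennreal_ofReal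
  have hsum : ∑' n : ℕ, ∫⁻ ω, ENNReal.ofReal (((√n)⁻¹ * Y n ω) ^ p) ∂μ ≠ ∞ := by
    have h1 (n : ℕ) : ∫⁻ ω, ENNReal.ofReal (((√n)⁻¹ * Y n ω) ^ p) ∂μ
        ≤ ENNReal.ofReal ((n : ℝ) ^ (-(p / 2))) * K := by
      simp only [heq]
      simp only [ENNReal.ofReal_mul (Real.rpow_nonneg (Nat.cast_nonneg n) _)]
      rw [lintegral_const_mul _ ((hY n).pow_const p).ennreal_ofReal]
      gcongr
      exact hbound n
    refine ne_top_of_le_ne_top ?_ (ENNReal.tsum_le_tsum h1)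
    rw [ENNReal.tsum_mul_right]
    refine ENNReal.mul_ne_top ?_ hK
    exact (Real.summable_nat_rpow.2 (by linarith)).tsum_ofReal_ne_top
  rw [← lintegral_tsum fun n => (hm n).aemeasurable] at hsum
  filter_upwards [ae_lt_top (Measurable.tsum hm) hsum] with ω hω
  have h1 := (ENNReal.tendsto_toReal ENNReal.zero_ne_top).comp
    (ENNReal.tendsto_atTop_zero_of_tsum_ne_top hω.ne)
  have h2 : Tendsto (fun n : ℕ => ((√n)⁻¹ * Y n ω) ^ p) atTop (𝓝 0) := by
    refine h1.congr fun n => ?_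
    have := hY0 n ω
    exact ENNReal.toReal_ofReal (by positivity)
  have h3 := h2.rpow_const (p := p⁻¹) (Or.inr (inv_nonneg.2 hp0.le))
  rw [Real.zero_rpow (inv_ne_zero hp0.ne')] at h3
  refine h3.congr fun n => ?_
  have := hY0 n ω
  exact Real.rpow_rpow_inv (by positivity) hp0.ne'

/-- A form of **Kronecker's lemma**. -/
lemma tendsto_inv_sqrt_mul_sum {a : ℕ → ℝ} (ha : ∀ k, 0 ≤ a k)
    (hs : Summable fun k : ℕ => ((k : ℝ) + 1) ^ (-(1 / 2) : ℝ) * a k) :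
    Tendsto (fun n : ℕ => (√n)⁻¹ * ∑ k ∈ Finset.range n, a k) atTop (𝓝 0) := by
  have h0 : Tendsto (fun n : ℕ => (√(n : ℝ))⁻¹) atTop (𝓝 0) :=
    tendsto_inv_atTop_zero.comp (Real.tendsto_sqrt_atTop.comp tendsto_natCast_atTop_atTop)
  -- Dominated convergence for series: for `k < n` the `k`-th term is at most `(k + 1) ^ (-1/2) * a
  -- k`, and for fixed `k` it tends to zero.
  have h := tendsto_tsum_of_dominated_convergence (𝓕 := atTop)
    (f := fun (n : ℕ) k => if k < n then (√n)⁻¹ * a k else 0) (g := fun _ => 0) hs (fun k => ?_)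
    (Eventually.of_forall fun n k => ?_)
  · rw [tsum_zero] at h
    refine h.congr fun n => ?_
    rw [tsum_eq_sum (s := Finset.range n) fun k hk => if_neg (by simpa using hk), Finset.mul_sum]
    exact Finset.sum_congr rfl fun k hk => if_pos (Finset.mem_range.1 hk)
  · have h1 := h0.mul_const (a k)
    rw [zero_mul] at h1
    refine h1.congr' ?_
    filter_upwards [eventually_gt_atTop k] with n hn
    rw [if_pos hn]
  · split_ifs with hk
    · rw [Real.norm_eq_abs, abs_of_nonneg (by have := ha k; positivity)]
      refine mul_le_mul_of_nonneg_right ?_ (ha k)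
      have hk' : (k : ℝ) + 1 ≤ n := by exact_mod_cast hk
      rw [Real.rpow_neg (by positivity), ← Real.sqrt_eq_rpow]
      gcongr
    · rw [norm_zero]
      have := ha k
      positivity

/-! ### Conditional laws and moments of the adaptive chain. -/

section Chain

variable {Ω 𝓧 Θ : Type*} [mΩ : MeasurableSpace Ω] [MeasurableSpace 𝓧] [MeasurableSpace Θ]
  {P : Θ → Kernel 𝓧 𝓧} {μ₀ : Measure (𝓧 × Θ)} {X : ℕ → Ω → 𝓧} {θ : ℕ → Ω → Θ} {Pr : Measure Ω}

lemma measurable_hist {Ω 𝓧 Θ : Type*} [MeasurableSpace 𝓧] [MeasurableSpace Θ] {X : ℕ → Ω → 𝓧}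
    {θ : ℕ → Ω → Θ} {k n : ℕ} (h : k ≤ n) :
    Measurable[hist X θ n] fun ω => (X k ω, θ k ω) :=
  (comap_measurable _).mono
    (le_iSup₂_of_le (f := fun (k : ℕ) (_ : k ≤ n) =>
      MeasurableSpace.comap (fun ω => (X k ω, θ k ω)) inferInstance) k h le_rfl) le_rfl

/-- The natural filtration of the adaptive chain. -/
def histFiltration (hX : ∀ n, Measurable (X n)) (hθ : ∀ n, Measurable (θ n)) : Filtration ℕ mΩ where
  seq := hist X θ
  mono' _ _ hmn := iSup₂_le fun _ hk => (measurable_hist (hk.trans hmn)).comap_le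
  le' _ := iSup₂_le fun k _ => ((hX k).prodMk (hθ k)).comap_le

namespace IsAdaptiveMarkovChain

lemma measurable_pair (hc : IsAdaptiveMarkovChain P μ₀ X θ Pr) (n : ℕ) :
    Measurable fun ω => (θ n ω, X n ω) := (hc.measurable_θ n).prodMk (hc.measurable_X n)

lemma measurable_pair_hist {Ω 𝓧 Θ : Type*} [MeasurableSpace 𝓧] [MeasurableSpace Θ] {X : ℕ → Ω → 𝓧}
    {θ : ℕ → Ω → Θ} (n : ℕ) : Measurable[hist X θ n] fun ω => (θ n ω, X n ω) :=
  measurable_swap.comp (measurable_hist le_rfl)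

lemma hist_le (hc : IsAdaptiveMarkovChain P μ₀ X θ Pr) (n : ℕ) : hist X θ n ≤ mΩ :=
  (histFiltration hc.measurable_X hc.measurable_θ).le n

variable [∀ θ, IsMarkovKernel (P θ)] [IsProbabilityMeasure Pr]

/-- The transition property is needed only for indicators; the identity of laws built on it yields
all later conditional statements. -/
lemma measure_inter_preimage (hc : IsAdaptiveMarkovChain P μ₀ X θ Pr)
    (hP : ∀ A : Set 𝓧, MeasurableSet A → Measurable (fun p : Θ × 𝓧 => P p.1 p.2 A)) (n : ℕ)
    {A : Set Ω} (hA : MeasurableSet[hist X θ n] A) {B : Set 𝓧} (hB : MeasurableSet B) :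
    Pr (A ∩ X (n + 1) ⁻¹' B) = ∫⁻ ω in A, P (θ n ω) (X n ω) B ∂Pr := by
  have hle := hc.hist_le n
  have hXB : MeasurableSet (X (n + 1) ⁻¹' B) := hc.measurable_X (n + 1) hB
  have hf : Measurable (B.indicator fun _ => (1 : ℝ)) := measurable_const.indicator hB
  have hfX : (fun ω => B.indicator (fun _ => (1 : ℝ)) (X (n + 1) ω))
      = (X (n + 1) ⁻¹' B).indicator fun _ => 1 := by
    ext ω; rfl
  have hint : Integrable (fun ω => B.indicator (fun _ => (1 : ℝ)) (X (n + 1) ω)) Pr := by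
    rw [hfX]; exact (integrable_const 1).indicator hXB
  have htr := hc.transition n _ hf (fun x => Set.indicator_nonneg (fun _ _ => zero_le_one) x) hint
  have h1 := setIntegral_condExp hle hint hA
  rw [setIntegral_congr_ae (hle A hA) (htr.mono fun ω h _ => h), hfX,
    setIntegral_indicator hXB] at h1
  simp only [integral_indicator hB, setIntegral_const, smul_eq_mul, mul_one] at h1
  have hPm : Measurable fun ω => P (θ n ω) (X n ω) B := (hP B hB).comp (hc.measurable_pair n)
  rw [← ENNReal.toReal_eq_toReal_iff' (measure_ne_top _ _), ← integral_toReal hPm.aemeasurable]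
  · exact h1.symm
  · exact ae_of_all _ fun ω => measure_lt_top _ _
  · refine ((lintegral_mono fun ω => prob_le_one).trans_lt ?_).ne
    simp

/-- The joint law of `(θ n, X n)` and `X (n + 1)` on an event of the past. -/
lemma map_restrict_eq_compProd (hc : IsAdaptiveMarkovChain P μ₀ X θ Pr)
    (hP : ∀ A : Set 𝓧, MeasurableSet A → Measurable (fun p : Θ × 𝓧 => P p.1 p.2 A)) (n : ℕ)
    {A : Set Ω} (hA : MeasurableSet[hist X θ n] A) :
    (Pr.restrict A).map (fun ω => ((θ n ω, X n ω), X (n + 1) ω))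
      = ((Pr.restrict A).map fun ω => (θ n ω, X n ω)) ⊗ₘ jointKernel P hP := by
  have hpair := hc.measurable_pair n
  have hle := hc.hist_le n
  refine Measure.ext_prod fun {s t} hs ht => ?_
  rw [Measure.compProd_apply_prod hs ht, Measure.map_apply (hpair.prodMk (hc.measurable_X _))
    (hs.prod ht), setLIntegral_map hs (Kernel.measurable_coe _ ht) hpair,
    Measure.restrict_apply (hpair.prodMk (hc.measurable_X _) (hs.prod ht)),
    Measure.restrict_restrict (hpair hs)]
  have hset : (fun ω => ((θ n ω, X n ω), X (n + 1) ω)) ⁻¹' (s ×ˢ t) ∩ A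
      = ((fun ω => (θ n ω, X n ω)) ⁻¹' s ∩ A) ∩ X (n + 1) ⁻¹' t := by
    ext ω
    simp only [Set.mem_inter_iff, Set.mem_preimage, Set.mem_prod]
    tauto
  rw [hset]
  exact hc.measure_inter_preimage hP n ((measurable_pair_hist n hs).inter hA) ht

/-- The increment depends on the present as well as on the next state, so the transition property
does not apply to it directly. Disintegrating the joint law on each past event reduces the claim to
the vanishing of the inner integral. -/
lemma condExp_eq_zero (hc : IsAdaptiveMarkovChain P μ₀ X θ Pr)
    (hP : ∀ A : Set 𝓧, MeasurableSet A → Measurable (fun p : Θ × 𝓧 => P p.1 p.2 A)) (n : ℕ)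
    {G : (Θ × 𝓧) × 𝓧 → ℝ} (hG : Measurable G)
    (hint : Integrable (fun ω => G ((θ n ω, X n ω), X (n + 1) ω)) Pr)
    (h0 : ∀ p : Θ × 𝓧, ∫ y, G (p, y) ∂(P p.1 p.2) = 0) :
    Pr[fun ω => G ((θ n ω, X n ω), X (n + 1) ω) | hist X θ n] =ᵐ[Pr] 0 := by
  have hle := hc.hist_le n
  have hm : Measurable fun ω => ((θ n ω, X n ω), X (n + 1) ω) :=
    (hc.measurable_pair n).prodMk (hc.measurable_X _)
  refine (ae_eq_condExp_of_forall_setIntegral_eq hle hint (fun s _ _ => integrableOn_zero)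
    (fun s hs _ => ?_) aestronglyMeasurable_zero).symm
  have hmap := hc.map_restrict_eq_compProd hP n hs
  have hi : Integrable G
      (((Pr.restrict s).map fun ω => (θ n ω, X n ω)) ⊗ₘ jointKernel P hP) := by
    rw [← hmap, integrable_map_measure hG.aestronglyMeasurable hm.aemeasurable]
    exact hint.restrict
  have h1 : ∫ ω in s, G ((θ n ω, X n ω), X (n + 1) ω) ∂Pr = 0 := by
    rw [← integral_map hm.aemeasurable hG.aestronglyMeasurable, hmap, Measure.integral_compProd hi]
    simp only [jointKernel_apply, h0, integral_zero]
  rw [h1]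
  simp

/-- Stated for extended nonnegative functions so that the drift can be iterated before `V (X n)` is
known to be integrable. -/
lemma lintegral_succ (hc : IsAdaptiveMarkovChain P μ₀ X θ Pr)
    (hP : ∀ A : Set 𝓧, MeasurableSet A → Measurable (fun p : Θ × 𝓧 => P p.1 p.2 A)) (n : ℕ)
    {f : 𝓧 → ℝ≥0∞} (hf : Measurable f) :
    ∫⁻ ω, f (X (n + 1) ω) ∂Pr = ∫⁻ ω, ∫⁻ y, f y ∂(P (θ n ω) (X n ω)) ∂Pr := by
  have hmap := hc.map_restrict_eq_compProd hP n (A := Set.univ) MeasurableSet.univ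
  rw [Measure.restrict_univ] at hmap
  have hm : Measurable fun ω => ((θ n ω, X n ω), X (n + 1) ω) :=
    (hc.measurable_pair n).prodMk (hc.measurable_X _)
  have hf2 : Measurable fun q : (Θ × 𝓧) × 𝓧 => f q.2 := hf.comp measurable_snd
  rw [← lintegral_map (f := fun q : (Θ × 𝓧) × 𝓧 => f q.2) hf2 hm, hmap,
    Measure.lintegral_compProd hf2, lintegral_map _ (hc.measurable_pair n)]
  · rfl
  · exact hf.lintegral_kernel (κ := jointKernel P hP)

lemma exists_lintegral_V_le {π : Measure 𝓧} (hc : IsAdaptiveMarkovChain P μ₀ X θ Pr)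
    (hP : ∀ A : Set 𝓧, MeasurableSet A → Measurable (fun p : Θ × 𝓧 => P p.1 p.2 A)) {V : 𝓧 → ℝ}
    (hA1 : AssumptionA1 P π μ₀ V) :
    ∃ K : ℝ, ∀ n, ∫⁻ ω, ENNReal.ofReal (V (X n ω)) ∂Pr ≤ ENNReal.ofReal K := by
  obtain ⟨b, lam, hb, hl0, hl1, hdr⟩ := hA1.drift
  have hVm : Measurable fun y => ENNReal.ofReal (V y) := hA1.measurable_V.ennreal_ofReal
  have h0 : ∫⁻ ω, ENNReal.ofReal (V (X 0 ω)) ∂Pr ≠ ∞ := by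
    have h := hA1.initial
    rw [← hc.initial, lintegral_map (f := fun p : 𝓧 × Θ => ENNReal.ofReal (V p.1))
      (hVm.comp measurable_fst) ((hc.measurable_X 0).prodMk (hc.measurable_θ 0))] at h
    exact h.ne
  refine ⟨_, fun n => le_ofReal_of_drift (u := fun n => ∫⁻ ω, ENNReal.ofReal (V (X n ω)) ∂Pr)
    (a := (∫⁻ ω, ENNReal.ofReal (V (X 0 ω)) ∂Pr).toReal) ENNReal.toReal_nonneg hb hl0 hl1
    (ENNReal.ofReal_toReal h0).ge (fun n => ?_) n⟩
  rw [hc.lintegral_succ hP n hVm]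
  exact lintegral_le_of_drift (V := fun ω => V (X n ω)) (hA1.measurable_V.comp (hc.measurable_X n))
    (fun ω => hA1.one_le_V _) hb hl0 fun ω => hdr _ _

end IsAdaptiveMarkovChain

end Chain

/-! ### Gaussian variance mixtures and the proof of the theorem. -/

/-- Convergence of characteristic functions to those of a variance mixture of Gaussian laws. -/
lemma tendstoInDistribution_sqrt_mul_gaussian {Ω : Type*} {mΩ : MeasurableSpace Ω} {μ : Measure Ω}
    [IsProbabilityMeasure μ] {Y : ℕ → Ω → ℝ} (hY : ∀ n, Measurable (Y n)) {Γ : Ω → ℝ}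
    (hΓ : AEMeasurable Γ μ) (hΓ0 : ∀ᵐ ω ∂μ, 0 ≤ Γ ω)
    (h : ∀ t : ℝ, Tendsto (fun n => ∫ ω, Complex.exp (((t * Y n ω : ℝ) : ℂ) * Complex.I) ∂μ) atTop
      (𝓝 (∫ ω, (gaussWeight t (Γ ω) : ℂ) ∂μ))) :
    TendstoInDistribution Y atTop (fun q : Ω × ℝ => Real.sqrt (Γ q.1) * q.2) (fun _ => μ)
      (μ.prod (gaussianReal 0 1)) := by
  have hm : AEMeasurable (fun q : Ω × ℝ => Real.sqrt (Γ q.1) * q.2) (μ.prod (gaussianReal 0 1)) :=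
    (Real.continuous_sqrt.measurable.comp_aemeasurable hΓ.comp_fst).mul
      measurable_snd.aemeasurable
  refine ⟨fun n => (hY n).aemeasurable, hm, ?_⟩
  refine ProbabilityMeasure.tendsto_iff_tendsto_charFun.2 fun t => ?_
  simp only [ProbabilityMeasure.coe_mk, charFun_apply_real]
  have hexp : Continuous fun x : ℝ => Complex.exp ((t : ℂ) * x * Complex.I) := by fun_prop
  rw [integral_map hm hexp.aestronglyMeasurable]
  have hlim : ∫ q : Ω × ℝ, Complex.exp ((t : ℂ) * ((Real.sqrt (Γ q.1) * q.2 : ℝ) : ℂ) * Complex.I)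
      ∂(μ.prod (gaussianReal 0 1)) = ∫ ω, (gaussWeight t (Γ ω) : ℂ) ∂μ := by
    rw [integral_prod]
    · refine integral_congr_ae ?_
      filter_upwards [hΓ0] with ω hω
      -- On the product space the Gaussian coordinate is independent of `Γ`; integrating it out
      -- first leaves the standard Gaussian characteristic function at `t √Γ`.
      have h1 := charFun_gaussianReal (μ := 0) (v := 1) (t * Real.sqrt (Γ ω))
      rw [charFun_apply_real] at h1
      calc _ = ∫ z, Complex.exp (((t * Real.sqrt (Γ ω) : ℝ) : ℂ) * z * Complex.I)
              ∂(gaussianReal 0 1) := by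
            congr 1; ext z; congr 1; push_cast; ring
        _ = _ := by
            rw [h1, gaussWeight, abs_of_nonneg hω, Complex.ofReal_exp]
            congr 1
            have h2 : ((Real.sqrt (Γ ω) : ℝ) : ℂ) ^ 2 = (Γ ω : ℂ) := by
              rw [← Complex.ofReal_pow, Real.sq_sqrt hω]
            push_cast
            rw [mul_pow, h2]
            ring
    · refine Integrable.of_bound (hexp.measurable.comp_aemeasurable hm).aestronglyMeasurable 1
        (ae_of_all _ fun q => ?_)
      have h3 := Complex.norm_exp_ofReal_mul_I (t * (Real.sqrt (Γ q.1) * q.2))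
      rw [Complex.ofReal_mul] at h3
      exact h3.le
  rw [hlim]
  refine (h t).congr fun n => ?_
  rw [integral_map (hY n).aemeasurable hexp.aestronglyMeasurable]
  simp only [Complex.ofReal_mul]

lemma add_rpow_le_of_rpow_le {a b x y p : ℝ} (ha : 0 ≤ a) (hb : 0 ≤ b) (hp : 0 ≤ p) (hx : a ^ p ≤ x)
    (hy : b ^ p ≤ y) : (a + b) ^ p ≤ 2 ^ p * (x + y) := by
  have hx0 : 0 ≤ x := (Real.rpow_nonneg ha p).trans hx
  have hy0 : 0 ≤ y := (Real.rpow_nonneg hb p).trans hy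
  rcases le_total a b with h | h
  · calc (a + b) ^ p ≤ (2 * b) ^ p := by gcongr; linarith
      _ = 2 ^ p * b ^ p := Real.mul_rpow zero_le_two hb
      _ ≤ _ := by gcongr; linarith
  · calc (a + b) ^ p ≤ (2 * a) ^ p := by gcongr; linarith
      _ = 2 ^ p * a ^ p := Real.mul_rpow zero_le_two ha
      _ ≤ _ := by gcongr; linarith

lemma rpow_rpow_le_self {v β p : ℝ} (hv : 1 ≤ v) (hβp : β * p ≤ 1) : (v ^ β) ^ p ≤ v := by
  rw [← Real.rpow_mul (zero_le_one.trans hv)]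
  exact rpow_le_self_of_one_le' hv hβp

/-- Decomposition of the partial sums into a martingale, boundary terms and a remainder. -/
lemma sum_Icc_eq_sum_add {S : Type*} (x : ℕ → S) (f : S → ℝ) (g : ℕ → S → ℝ) (n : ℕ) :
    ∑ k ∈ Finset.Icc 1 n, f (x k)
      = ∑ k ∈ Finset.range n, (g k (x (k + 1)) - (g k (x k) - f (x k)))
        + ((g 0 (x 0) - f (x 0)) - (g n (x n) - f (x n))
          + ∑ k ∈ Finset.range n, (g (k + 1) (x (k + 1)) - g k (x (k + 1)))) := by
  induction n with
  | zero => simp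
  | succ n ih =>
    rw [Finset.sum_Icc_succ_top (by omega), ih, Finset.sum_range_succ, Finset.sum_range_succ]
    ring

/-- The weights are strictly positive, so a finite series forces every distance to be finite, and
passing to real numbers loses nothing. -/
lemma summable_kernelDist {S Θ : Type*} [MeasurableSpace S] {P : Θ → Kernel S S} {V : S → ℝ}
    {β : ℝ} (hV : ∀ x, 1 ≤ V x ^ β) {x : ℕ → S} {τ : ℕ → Θ}
    (h : ∑' k : ℕ, ENNReal.ofReal (((k : ℝ) + 1) ^ (-(1 / 2) : ℝ)) *
      kernelDist P V β (τ (k + 1)) (τ k) * ENNReal.ofReal (V (x (k + 1)) ^ β) < ∞) :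
    (∀ k, kernelDist P V β (τ (k + 1)) (τ k) ≠ ∞) ∧
      Summable fun k : ℕ => ((k : ℝ) + 1) ^ (-(1 / 2) : ℝ) *
        ((kernelDist P V β (τ (k + 1)) (τ k)).toReal * V (x (k + 1)) ^ β) := by
  have hpos (k : ℕ) : 0 < ((k : ℝ) + 1) ^ (-(1 / 2) : ℝ) := by positivity
  refine ⟨fun k htop => ?_, ?_⟩
  · have hk := ENNReal.ne_top_of_tsum_ne_top h.ne k
    refine hk ?_
    rw [htop, ENNReal.mul_top (ENNReal.ofReal_pos.2 (hpos k)).ne', ENNReal.top_mul]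
    exact (ENNReal.ofReal_pos.2 (by linarith [hV (x (k + 1))])).ne'
  · refine (ENNReal.summable_toReal h.ne).congr fun k => ?_
    rw [ENNReal.toReal_mul, ENNReal.toReal_mul, ENNReal.toReal_ofReal (hpos k).le,
      ENNReal.toReal_ofReal (by linarith [hV (x (k + 1))]), mul_assoc]

end AdaptiveMCMC

theorem proposition3p1 {Ω 𝓧 Θ : Type*} [MeasurableSpace Ω] [MeasurableSpace 𝓧]
    [MeasurableSpace.CountablyGenerated 𝓧] [MeasurableSpace Θ]
    (P : Θ → Kernel 𝓧 𝓧) [∀ θ, IsMarkovKernel (P θ)]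
    (hP : ∀ A : Set 𝓧, MeasurableSet A → Measurable (fun p : Θ × 𝓧 => P p.1 p.2 A))
    (π : Measure 𝓧) [IsProbabilityMeasure π]
    (μ₀ : Measure (𝓧 × Θ)) [IsProbabilityMeasure μ₀]
    (Pr : Measure Ω) [IsProbabilityMeasure Pr]
    (X : ℕ → Ω → 𝓧) (θ : ℕ → Ω → Θ)
    (hchain : AdaptiveMCMC.IsAdaptiveMarkovChain P μ₀ X θ Pr)
    (V : 𝓧 → ℝ) (hA1 : AdaptiveMCMC.AssumptionA1 P π μ₀ V)
    (β : ℝ) (hβ : β ∈ Set.Ico (0 : ℝ) (1 / 2))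
    (hβ0 : β = 0 → AdaptiveMCMC.GeomErgodic P π V 0)
    (h : 𝓧 → ℝ) (hh : AdaptiveMCMC.MemLW (fun x => V x ^ β) h) (hπ : ∫ x, h x ∂π = 0)
    (Γsq : Ω → ℝ) (hΓm : AEMeasurable Γsq Pr) (hΓ0 : ∀ᵐ ω ∂Pr, 0 ≤ Γsq ω)
    (hΓ : TendstoInMeasure Pr
      (fun (n : ℕ) ω => (n : ℝ)⁻¹ * ∑ k ∈ Finset.range n,
        (AdaptiveMCMC.mgIncrement (P (θ k ω)) π h (X k ω) (X (k + 1) ω)) ^ 2) atTop Γsq)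
    (hdim : ∀ᵐ ω ∂Pr, ∑' k : ℕ, ENNReal.ofReal (((k : ℝ) + 1) ^ (-(1 / 2) : ℝ)) *
      AdaptiveMCMC.kernelDist P V β (θ (k + 1) ω) (θ k ω) *
        ENNReal.ofReal (V (X (k + 1) ω) ^ β) < ∞) :
    TendstoInDistribution
      (fun (n : ℕ) ω => (Real.sqrt n)⁻¹ * ∑ k ∈ Finset.Icc 1 n, h (X k ω)) atTop
      (fun q : Ω × ℝ => Real.sqrt (Γsq q.1) * q.2)
      (fun _ => Pr) (Pr.prod (gaussianReal 0 1)) := by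
  open AdaptiveMCMC in
  obtain ⟨hβ1, hβ2⟩ := hβ
  have hG : GeomErgodic P π V β := by
    rcases hβ1.eq_or_lt with h0 | h0
    · rw [← h0]; exact hβ0 h0.symm
    · exact hA1.ergodic β h0 (by linarith)
  obtain ⟨ρ, C, H⟩ := hA1.exists_isErgodicKernel hβ1 (by linarith) hG
  have hW1 (x : 𝓧) : 1 ≤ V x ^ β := one_le_rpow_of_one_le (hA1.one_le_V x) hβ1
  have hWm : Measurable fun x => V x ^ β := hA1.measurable_V.pow_const β
  have hhm : Measurable h := hh.1
  obtain ⟨c, hc0, hc⟩ := hh.exists_abs_le hW1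
  set g : Θ → 𝓧 → ℝ := fun θ => resolvent (P θ) π h
  have hgm : Measurable fun p : Θ × 𝓧 => g p.1 p.2 :=
    measurable_resolvent_uncurry hP H hhm hc0 hc hπ
  have hpoisson (θ : Θ) (x : 𝓧) : ∫ z, g θ z ∂(P θ x) = g θ x - h x :=
    (H θ).integral_resolvent hhm hc0 hc hπ x
  obtain ⟨L, hL0, hgL, hgL'⟩ : ∃ L : ℝ, 0 ≤ L ∧ (∀ θ x, |g θ x| ≤ L * V x ^ β) ∧
      ∀ θ x, |g θ x - h x| ≤ L * V x ^ β := by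
    by_cases hΘ : Nonempty Θ
    · obtain ⟨θ₀⟩ := hΘ
      have hK : 0 ≤ C * (1 - ρ)⁻¹ :=
        mul_nonneg (H θ₀).const_nonneg (inv_nonneg.2 (by linarith [(H θ₀).rate_lt_one]))
      have hgb (θ : Θ) (x : 𝓧) := (H θ).abs_resolvent_le hhm hc0 hc hπ x
      refine ⟨c * (C * (1 - ρ)⁻¹) + c, by positivity, fun θ x => ?_, fun θ x => ?_⟩
      · refine (hgb θ x).trans ?_
        have := hW1 x
        gcongr
        linarith
      · refine (abs_sub _ _).trans ?_
        rw [add_mul]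
        exact add_le_add (hgb θ x) (hc x)
    · exact ⟨0, le_rfl, fun θ => (hΘ ⟨θ⟩).elim, fun θ => (hΘ ⟨θ⟩).elim⟩
  -- the martingale increments
  set G : (Θ × 𝓧) × 𝓧 → ℝ := fun q => g q.1.1 q.2 - (g q.1.1 q.1.2 - h q.1.2) with hG_def
  have hGm : Measurable G :=
    (hgm.comp ((measurable_fst.comp measurable_fst).prodMk measurable_snd)).sub
      ((hgm.comp measurable_fst).sub (hhm.comp (measurable_snd.comp measurable_fst)))
  -- The Poisson equation trades the integral `P g` for `g - h`, which makes joint measurability of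
  -- the increment immediate.
  have hGinc (θ : Θ) (x y : 𝓧) : mgIncrement (P θ) π h x y = G ((θ, x), y) := by
    simp only [mgIncrement, hG_def]
    rw [← hpoisson]
  simp only [hGinc] at hΓ
  have hG0 (p : Θ × 𝓧) : ∫ y, G (p, y) ∂(P p.1 p.2) = 0 := by
    have hi : Integrable (g p.1) (P p.1 p.2) := by
      refine IsErgodicKernel.integrable_of_le (W := fun y => V y ^ β) ?_
        (hgm.comp (measurable_const.prodMk measurable_id)) (hgL p.1)
      simpa using (H p.1).integrable_pow 1 p.2
    simp only [hG_def]
    rw [integral_sub hi (integrable_const _), hpoisson]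
    simp
  set D : ℕ → Ω → ℝ := fun k ω => G ((θ k ω, X k ω), X (k + 1) ω)
  let ℱ := histFiltration hchain.measurable_X hchain.measurable_θ
  have hDℱ (k : ℕ) : Measurable[ℱ (k + 1)] (D k) := by
    refine hGm.comp (Measurable.prodMk ?_ ?_)
    · exact measurable_swap.comp (measurable_hist (X := X) (θ := θ) (Nat.le_succ k))
    · exact measurable_fst.comp (measurable_hist (X := X) (θ := θ) (le_refl (k + 1)))
  have hDm (k : ℕ) : Measurable (D k) := (hDℱ k).mono (ℱ.le _) le_rfl
  -- moments
  obtain ⟨p, hp2, hp3, hβp⟩ : ∃ p : ℝ, 2 < p ∧ p ≤ 3 ∧ β * p ≤ 1 := by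
    -- The largest exponent with `β * p ≤ 1`, capped at three; it exceeds two because `β < 1/2`.
    refine ⟨(max β (1 / 3))⁻¹, ?_, ?_, ?_⟩
    · rw [lt_inv_comm₀ two_pos (by positivity)]
      exact max_lt (by linarith) (by norm_num)
    · rw [inv_le_comm₀ (by positivity) three_pos]
      exact le_max_of_le_right (by norm_num)
    · rw [← div_eq_mul_inv, div_le_one (by positivity)]
      exact le_max_left _ _
  obtain ⟨K, hK⟩ := hchain.exists_lintegral_V_le hP hA1
  have hVX (n : ℕ) : Integrable (fun ω => V (X n ω)) Pr :=
    AssumptionA1.integrable_V_of_lintegral_lt_top (hA1.measurable_V.comp (hchain.measurable_X n))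
      (fun ω => hA1.one_le_V _) ((hK n).trans_lt ENNReal.ofReal_lt_top)
  have hVK (n : ℕ) : ∫ ω, V (X n ω) ∂Pr ≤ max K 0 := by
    rw [integral_eq_lintegral_of_nonneg_ae
      (ae_of_all _ fun ω => zero_le_one.trans (hA1.one_le_V _)) (hVX n).1]
    exact ENNReal.toReal_le_of_le_ofReal (le_max_right _ _)
      ((hK n).trans (ENNReal.ofReal_le_ofReal (le_max_left _ _)))
  have hDp_le (k : ℕ) (ω : Ω) :
      |D k ω| ^ p ≤ L ^ p * (2 ^ p * (V (X (k + 1) ω) + V (X k ω))) := by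
    have h1 : |D k ω| ≤ L * (V (X (k + 1) ω) ^ β + V (X k ω) ^ β) := by
      rw [mul_add]
      exact (abs_sub _ _).trans (add_le_add (hgL _ _) (hgL' _ _))
    have ha := zero_le_one.trans (hW1 (X (k + 1) ω))
    have hb := zero_le_one.trans (hW1 (X k ω))
    calc _ ≤ (L * (V (X (k + 1) ω) ^ β + V (X k ω) ^ β)) ^ p := by gcongr
      _ = L ^ p * (V (X (k + 1) ω) ^ β + V (X k ω) ^ β) ^ p := Real.mul_rpow hL0 (add_nonneg ha hb)
      _ ≤ _ := by
        gcongr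
        exact add_rpow_le_of_rpow_le ha hb (by linarith)
          (rpow_rpow_le_self (hA1.one_le_V _) hβp) (rpow_rpow_le_self (hA1.one_le_V _) hβp)
  have hDp_bd (k : ℕ) : Integrable
      (fun ω => L ^ p * (2 ^ p * (V (X (k + 1) ω) + V (X k ω)))) Pr :=
    (((hVX (k + 1)).add (hVX k)).const_mul _).const_mul _
  have hDp (k : ℕ) : Integrable (fun ω => |D k ω| ^ p) Pr := by
    refine (hDp_bd k).mono' ((hDm k).abs.pow_const p).aestronglyMeasurable (ae_of_all _ fun ω => ?_)
    rw [Real.norm_eq_abs, abs_of_nonneg (by positivity)]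
    exact hDp_le k ω
  have hDpK (k : ℕ) : ∫ ω, |D k ω| ^ p ∂Pr ≤ L ^ p * (2 ^ p * (max K 0 + max K 0)) := by
    refine (integral_mono (hDp k) (hDp_bd k) (hDp_le k)).trans ?_
    rw [integral_const_mul, integral_const_mul, integral_add (hVX (k + 1)) (hVX k)]
    gcongr
    · exact hVK _
    · exact hVK _
  have hDint (k : ℕ) : Integrable (D k) Pr := by
    refine ((integrable_const (1 : ℝ)).add (hDp k)).mono' (hDm k).aestronglyMeasurable
      (ae_of_all _ fun ω => ?_)
    rw [Real.norm_eq_abs]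
    have h0 : 0 ≤ |D k ω| ^ p := by positivity
    change |D k ω| ≤ 1 + |D k ω| ^ p
    rcases le_total |D k ω| 1 with h1 | h1
    · linarith
    · linarith [Real.self_le_rpow_of_one_le h1 (by linarith : 1 ≤ p)]
  have hmart (k : ℕ) : Pr[D k | ℱ k] =ᵐ[Pr] 0 :=
    hchain.condExp_eq_zero hP k hGm (hDint k) hG0
  have hclt := tendstoInDistribution_sqrt_mul_gaussian
    (Y := fun (n : ℕ) ω => (Real.sqrt n)⁻¹ * ∑ k ∈ Finset.range n, D k ω)
    (fun n => (Finset.measurable_fun_sum _ fun k _ => hDm k).const_mul _) hΓm hΓ0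
    fun t => tendsto_integral_exp_martingale hDℱ hmart hp2 hp3 hDp hDpK hΓ t
  -- the remainder
  have hSm (n : ℕ) : Measurable fun ω => (Real.sqrt n)⁻¹ * ∑ k ∈ Finset.Icc 1 n, h (X k ω) :=
    (Finset.measurable_fun_sum _ fun k _ => hhm.comp (hchain.measurable_X k)).const_mul _
  -- Slutsky: it remains to show that the normalised sum and the normalised martingale differ by a
  -- term tending to zero almost surely.
  refine tendstoInDistribution_of_tendstoInMeasure_sub _ _ hclt ?_ fun n => (hSm n).aemeasurable
  refine tendstoInMeasure_of_tendsto_ae (fun n => ?_) ?_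
  · exact ((hSm n).sub ((Finset.measurable_fun_sum _ fun k _ =>
      hDm k).const_mul _)).aestronglyMeasurable
  have hWX := ae_tendsto_inv_sqrt_mul (μ := Pr) (Y := fun n ω => V (X n ω) ^ β)
    (fun n => hWm.comp (hchain.measurable_X n)) (fun n ω => zero_le_one.trans (hW1 _)) hp2
    (K := ENNReal.ofReal K) ENNReal.ofReal_ne_top fun n => (lintegral_mono fun ω =>
      ENNReal.ofReal_le_ofReal (rpow_rpow_le_self (hA1.one_le_V _) hβp)).trans (hK n)
  filter_upwards [hdim, hWX] with ω hω hωW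
  obtain ⟨hfin, hsum⟩ := summable_kernelDist hW1 (x := fun k => X k ω) (τ := fun k => θ k ω) hω
  have h0 : Tendsto (fun n : ℕ => (Real.sqrt n)⁻¹) atTop (𝓝 0) :=
    tendsto_inv_atTop_zero.comp (Real.tendsto_sqrt_atTop.comp tendsto_natCast_atTop_atTop)
  have hkron := tendsto_inv_sqrt_mul_sum (fun k => mul_nonneg ENNReal.toReal_nonneg
    (zero_le_one.trans (hW1 (X (k + 1) ω)))) hsum
  -- The three terms bound the boundary term at time zero, the boundary term at time `n`, and the
  -- effect of the parameter changes.
  have hbound := ((h0.mul_const (L * V (X 0 ω) ^ β)).add (hωW.const_mul L)).add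
    (hkron.const_mul (c * (C * (1 - ρ)⁻¹) ^ 2))
  simp only [zero_mul, mul_zero, add_zero] at hbound
  refine squeeze_zero_norm (fun n => ?_) hbound
  have hdec := sum_Icc_eq_sum_add (fun k => X k ω) h (fun k => g (θ k ω)) n
  simp only [Pi.sub_apply]
  have hs : (0 : ℝ) ≤ (Real.sqrt n)⁻¹ := by positivity
  rw [hdec, ← mul_sub, show ∑ k ∈ Finset.range n, D k ω = ∑ k ∈ Finset.range n,
    (g (θ k ω) (X (k + 1) ω) - (g (θ k ω) (X k ω) - h (X k ω))) from rfl, add_sub_cancel_left,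
    norm_mul, Real.norm_eq_abs, Real.norm_eq_abs, abs_of_nonneg hs]
  have hR : |∑ k ∈ Finset.range n,
      (g (θ (k + 1) ω) (X (k + 1) ω) - g (θ k ω) (X (k + 1) ω))|
      ≤ c * (C * (1 - ρ)⁻¹) ^ 2 * ∑ k ∈ Finset.range n,
        (kernelDist P V β (θ (k + 1) ω) (θ k ω)).toReal * V (X (k + 1) ω) ^ β := by
    rw [Finset.mul_sum]
    exact (Finset.abs_sum_le_sum_abs _ _).trans (Finset.sum_le_sum fun k _ =>
      abs_resolvent_sub_le H hhm hc0 hc hπ (hfin k) _)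
  calc _ ≤ (Real.sqrt n)⁻¹ * (L * V (X 0 ω) ^ β + L * V (X n ω) ^ β
        + c * (C * (1 - ρ)⁻¹) ^ 2 * ∑ k ∈ Finset.range n,
          (kernelDist P V β (θ (k + 1) ω) (θ k ω)).toReal * V (X (k + 1) ω) ^ β) := by
        gcongr
        refine (abs_add_le _ _).trans (add_le_add ((abs_sub _ _).trans ?_) hR)
        exact add_le_add (hgL' _ _) (hgL' _ _)
    _ = _ := by ring
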